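/- Let $\ell,G>0$ and let $L=(L_+,L_-)$ be a pair of smooth $2\pi$-periodic real functions. The Bañados geometry of $L$ is the metric $$ds^2=\ell^2\frac{dr^2}{r^2}-\Big(r\,dx^+-\ell^2\frac{L_-(x^-)\,dx^-}{r}\Big)\Big(r\,dx^--\ell^2\frac{L_+(x^+)\,dx^+}{r}\Big),\qquad x^\pm=t/\ell\pm\varphi,\ \ \varphi\sim\varphi+2\pi,$$ on the patch $r>0$, $r^4\ne\ell^4L_+L_-$. For a pair $\epsilon=(\epsilon_+,\epsilon_-)$ of smooth $2\pi$-periodic functions of $x^+$, $x^-$ let $$\chi(\epsilon;L)=-\tfrac r2(\epsilon_+'+\epsilon_-')\partial_r+\Big(\epsilon_++\tfrac{\ell^2r^2\epsilon_-''+\ell^4L_-\epsilon_+''}{2(r^4-\ell^4L_+L_-)}\Big)\partial_++\Big(\epsilon_-+\tfrac{\ell^2r^2\epsilon_+''+\ell^4L_+\epsilon_-''}{2(r^4-\ell^4L_+L_-)}\Big)\partial_-,$$ $$\delta_\epsilon L_\pm=\epsilon_\pm L_\pm'+2L_\pm\epsilon_\pm'-\tfrac12\epsilon_\pm'''.$$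 For field dependent parameters $a(L),b(L)$ the adjusted bracket is $$[\chi(a;L),\chi(b;L)]_*=[\chi(a;L),\chi(b;L)]_{\rm Lie}-\big(\delta^L_{a}\chi(b;L)-\delta^L_{b}\chi(a;L)\big),$$ where $\delta^L_{a}\chi(b;L)=\frac{d}{ds}\big|_{s=0}\chi(b(L+s\,\delta_{a}L);L+s\,\delta_{a}L)$. **(1) Killing vectors.** The field $\chi(\epsilon;L)$ is a global Killing vector of the geometry (smooth on the patch and compatible with $\varphi\sim\varphi+2\pi$) if and only if $\delta_\epsilon L=0$, i.e. $\epsilon_\pm'''-4L_\pm\epsilon_\pm'-2\epsilon_\pm L_\pm'=0$. Every Bañados geometry has two linearly independent, commuting global Killing vectors $\zeta_+=\chi((K_+,0);L)$ and $\zeta_-=\chi((0,K_-);L)$, where $K_\pm\neq0$ is a real smooth $2\pi$-periodic product of two (complex, possibly equal) solutions of Hill's equation $\psi''=L_\pm\psi$. **(2) Field dependent choice.** Call a smooth $2\pi$-periodic function $f$ exceptional if all solutions of $k'''-4fk'-2kf'=0$ are $2\pi$-periodic. There is a functional $f\mapsto K(f)$ on the smooth $2\pi$-periodic functions such that $K(f)$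 is a $2\pi$-periodic solution of this equation and a product of two solutions of $\psi''=f\psi$; for $f$ not exceptional, $K(f)\ne0$ and every $2\pi$-periodic solution is a multiple of $K(f)$; $K(f_s)(x)$ is smooth in $(s,x)$ for every smooth family $f_s$ (at exceptional $f$ the value $K(f)=0$ is allowed); and $K(c)=1$ for every constant $c\ge0$. With $K_\pm=K(L_\pm)$ and the corresponding $\zeta_\pm$, for every $L$ and every field independent $\epsilon$, $$[\chi(\epsilon;L),\zeta_\pm]_*=0 .$$ **(3) Charges.** Let $\delta J_\pm=\frac{\ell}{8\pi G}\int_0^{2\pi}d\varphi\,K_\pm\,\delta L_\pm$, at any fixed $t$, be the infinitesimal charge of $\zeta_\pm$. * Integrability: $\delta_1(\delta_2J_\pm)=\frac{\ell}{8\pi G}\oint(\delta_1K_\pm)\,\delta_2L_\pm$ is symmetric under $1\leftrightarrow2$, and there is a functional $J$ such that $J_\pm=J(L_\pm)$ has the variation $\delta J_\pm$ along every smooth path in phase space. * With $\{Q_{\chi(\epsilon)},Q\}=-\delta_{\epsilon}Q$ (extended complex linearly in $\epsilon$), and $L_n$, $\bar L_n=\frac{\ell}{8\pi G}\int_0^{2\pi}d\varphi\,e^{inx^\pm}L_\pm(x^\pm)$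 the Virasoro charges, generated by $\epsilon_\pm=e^{inx^\pm}$: for all $n\in\mathbb Z$ and at every $L$, $\{J_\pm,L_n\}=\{J_\pm,\bar L_n\}=0$ and $\{L_n,J_\pm\}=\{\bar L_n,J_\pm\}=0$. Moreover, for every $L$ (exceptional or not), every $2\pi$-periodic solution $k$ of $k'''-4L_\pm k'-2kL_\pm'=0$ and every $\epsilon$, $\oint k\,\delta_\epsilon L_\pm=0$. * $J$ is constant on Virasoro coadjoint orbits: $J(h'^2\,f\circ h-\tfrac12S[h])=J(f)$ for every smooth $h$ with $h'>0$ and $h(x+2\pi)=h(x)+2\pi$, where $S[h]=\frac{h'''}{h'}-\frac{3h''^2}{2h'^2}$. * BTZ sector: if $f=h'^2c-\tfrac12S[h]$ with $h$ as above lies on the orbit of a constant $c\ge0$, then $J(f)=\frac{\ell}{4G}c$. Thus $J_\pm=\frac{\ell}{4G}L_\pm$, with $L_\pm$ the constant representative. -/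

import Mathlib

open scoped ContDiff

noncomputable section

namespace Banados

/-- The two chiral sectors of the phase space. -/
inductive Sector
  | plus
  | minus
  deriving DecidableEq

/-- `x^± = t / ℓ ± φ`. -/
def Sector.sign : Sector → ℝ
  | .plus => 1
  | .minus => -1

/-- The light-cone coordinate `x^± = t / ℓ ± φ`. -/
def lightCone (ℓ t φ : ℝ) (σ : Sector) : ℝ := t / ℓ + σ.sign * φ

/-- A pair `(f_+, f_-)` of functions of one variable, `f_±` being a function of `x^±`. It serves
for the fields `(L_+, L_-)`, for their variations, and for parameters `(ε_+, ε_-)`. -/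
abbrev Fields := Sector → ℝ → ℝ

/-- A smooth single-valued (that is, `2π`-periodic) function. -/
structure IsCircleField (f : ℝ → ℝ) : Prop where
  smooth : ContDiff ℝ ∞ f
  periodic : Function.Periodic f (2 * Real.pi)

/-- A pair of smooth single-valued functions. Such an `L = (L_+, L_-)` is a point of the
Bañados phase space, such an `ε` is the parameter of a symplectic symmetry. -/
def IsSingleValued (f : Fields) : Prop := ∀ σ, IsCircleField (f σ)

/-! ### The metric and its Killing vectors -/

/-- Coordinates `(r, x^+, x^-)`, with indices `0, 1, 2`. -/
abbrev Coord := Fin 3 → ℝ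

/-- The components of the Bañados metric in the coordinates `(r, x^+, x^-)`. -/
def metric (ℓ : ℝ) (L : Fields) (p : Coord) : Matrix (Fin 3) (Fin 3) ℝ :=
  !![ℓ ^ 2 / p 0 ^ 2, 0, 0;
     0, ℓ ^ 2 * L .plus (p 1),
       -(p 0 ^ 2 + ℓ ^ 4 * L .plus (p 1) * L .minus (p 2) / p 0 ^ 2) / 2;
     0, -(p 0 ^ 2 + ℓ ^ 4 * L .plus (p 1) * L .minus (p 2) / p 0 ^ 2) / 2,
       ℓ ^ 2 * L .minus (p 2)]

/-- The metric is the line element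
`ℓ² dr²/r² - (r dx^+ - ℓ² L_- dx^- / r) (r dx^- - ℓ² L_+ dx^+ / r)`. -/
theorem metric_lineElement (ℓ : ℝ) (L : Fields) (p v : Coord) (hp : p 0 ≠ 0) :
    (∑ i, ∑ j, metric ℓ L p i j * v i * v j) =
      ℓ ^ 2 * v 0 ^ 2 / p 0 ^ 2
        - (p 0 * v 1 - ℓ ^ 2 * L .minus (p 2) * v 2 / p 0)
          * (p 0 * v 2 - ℓ ^ 2 * L .plus (p 1) * v 1 / p 0) := by
  simp [metric, Fin.sum_univ_three]
  field_simp
  ring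

/-- The coordinate patch: `r > 0`, away from the locus where the metric degenerates. -/
def patch (ℓ : ℝ) (L : Fields) : Set Coord :=
  {p | 0 < p 0 ∧ p 0 ^ 4 ≠ ℓ ^ 4 * L .plus (p 1) * L .minus (p 2)}

/-- The Lie derivative `V^ρ ∂_ρ g_{μν} + g_{ρν} ∂_μ V^ρ + g_{μρ} ∂_ν V^ρ`. -/
def lieDerivative (g : Coord → Matrix (Fin 3) (Fin 3) ℝ) (V : Coord → Coord) (p : Coord)
    (μ ν : Fin 3) : ℝ :=
  fderiv ℝ (fun q => g q μ ν) p (V p)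
    + ∑ ρ, (g p ρ ν * fderiv ℝ (fun q => V q ρ) p (Pi.single μ 1)
      + g p μ ρ * fderiv ℝ (fun q => V q ρ) p (Pi.single ν 1))

/-- `V` is a Killing vector field of the Bañados geometry, smooth on the whole patch and
compatible with the identification `φ ∼ φ + 2π`, i.e. `(x^+, x^-) ∼ (x^+ + 2π, x^- - 2π)`. -/
structure IsGlobalKilling (ℓ : ℝ) (L : Fields) (V : Coord → Coord) : Prop where
  smooth : ContDiffOn ℝ ∞ V (patch ℓ L)
  periodic : ∀ p ∈ patch ℓ L, V (p + ![0, 2 * Real.pi, -(2 * Real.pi)]) = V p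
  killing : ∀ p ∈ patch ℓ L, ∀ μ ν, lieDerivative (metric ℓ L) V p μ ν = 0

/-! ### Symplectic symmetries and the adjusted bracket -/

/-- The vector field `χ(ε; L)`. -/
def chi (ℓ : ℝ) (ε L : Fields) (p : Coord) : Coord :=
  ![-(p 0 / 2) * (deriv (ε .plus) (p 1) + deriv (ε .minus) (p 2)),
    ε .plus (p 1)
      + (ℓ ^ 2 * p 0 ^ 2 * iteratedDeriv 2 (ε .minus) (p 2)
          + ℓ ^ 4 * L .minus (p 2) * iteratedDeriv 2 (ε .plus) (p 1))
        / (2 * (p 0 ^ 4 - ℓ ^ 4 * L .plus (p 1) * L .minus (p 2))),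
    ε .minus (p 2)
      + (ℓ ^ 2 * p 0 ^ 2 * iteratedDeriv 2 (ε .plus) (p 1)
          + ℓ ^ 4 * L .plus (p 1) * iteratedDeriv 2 (ε .minus) (p 2))
        / (2 * (p 0 ^ 4 - ℓ ^ 4 * L .plus (p 1) * L .minus (p 2)))]

/-- `δ_ε L_± = ε_± L_±' + 2 L_± ε_±' - ε_±''' / 2`. -/
def deltaL (ε L : Fields) : Fields := fun σ x =>
  ε σ x * deriv (L σ) x + 2 * L σ x * deriv (ε σ) x - iteratedDeriv 3 (ε σ) x / 2

/-- The variation `δ^L_ε χ(b(L); L)`: derivative in the direction `δ_ε L` of the field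
dependent vector field with field dependent parameter `b`, at a fixed spacetime point. -/
def chiVariation (ℓ : ℝ) (ε : Fields) (b : Fields → Fields) (L : Fields) (p : Coord) : Coord :=
  deriv (fun s : ℝ => chi ℓ (b (L + s • deltaL ε L)) (L + s • deltaL ε L) p) 0

/-- The adjusted bracket `[χ(a(L); L), χ(b(L); L)]_*` of field dependent vector fields. -/
def adjustedBracket (ℓ : ℝ) (a b : Fields → Fields) (L : Fields) (p : Coord) : Coord :=
  VectorField.lieBracket ℝ (chi ℓ (a L) L) (chi ℓ (b L) L) p
    - (chiVariation ℓ (a L) b L p - chiVariation ℓ (b L) a L p)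

/-! ### Hill's equation and the stabilizer equation (one sector) -/

/-- `ψ` is a (complex) solution of Hill's equation `ψ'' = f ψ`. -/
structure IsHillSolution (f : ℝ → ℝ) (ψ : ℝ → ℂ) : Prop where
  smooth : ContDiff ℝ ∞ ψ
  eqn : ∀ x, iteratedDeriv 2 ψ x = f x * ψ x

/-- `k` is a product of two (possibly equal) solutions of Hill's equation. -/
def IsHillProduct (f k : ℝ → ℝ) : Prop :=
  ∃ ψ₁ ψ₂ : ℝ → ℂ, IsHillSolution f ψ₁ ∧ IsHillSolution f ψ₂ ∧ ∀ x, (k x : ℂ) = ψ₁ x * ψ₂ x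

/-- `k` solves the stabilizer equation `k''' - 4 f k' - 2 k f' = 0` on the real line. -/
structure IsStabilizer (f k : ℝ → ℝ) : Prop where
  smooth : ContDiff ℝ ∞ k
  eqn : ∀ x, iteratedDeriv 3 k x - 4 * f x * deriv k x - 2 * k x * deriv f x = 0

/-- All three local Killing directions of the sector are globally defined (as for global AdS₃
and its descendants). -/
def IsExceptional (f : ℝ → ℝ) : Prop :=
  ∀ k, IsStabilizer f k → Function.Periodic k (2 * Real.pi)

/-- The parameter of `ζ_±`: the function `K(L_±)` in the sector `σ = ±`, zero in the other. -/
def killingParam (K : (ℝ → ℝ) → ℝ → ℝ) (σ : Sector) (L : Fields) : Fields :=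
  Pi.single σ (K (L σ))

/-! ### Charges -/

/-- `(ℓ / 8πG) ∮ dφ k v`, over the circle of constant `t`. With `k = K_±` and `v = δL_±` it is
the infinitesimal Killing charge `δJ_±`. -/
def chargeVariation (ℓ G t : ℝ) (σ : Sector) (k v : ℝ → ℝ) : ℝ :=
  ℓ / (8 * Real.pi * G)
    * ∫ φ in (0 : ℝ)..(2 * Real.pi), k (lightCone ℓ t φ σ) * v (lightCone ℓ t φ σ)

/-- The parameter of `χ_n^±`: `e^{i n x^±}` in the sector `σ = ±`, zero in the other. -/
def modeParam (σ : Sector) (n : ℤ) : Sector → ℝ → ℂ :=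
  Pi.single σ (fun x : ℝ => Complex.exp (Complex.I * n * x))

/-- The Virasoro charges: `L_n` for `σ = +` and `L̄_n` for `σ = -`. -/
def virasoroCharge (ℓ G t : ℝ) (σ : Sector) (n : ℤ) (L : Fields) : ℂ :=
  (ℓ / (8 * Real.pi * G) : ℝ)
    * ∫ φ in (0 : ℝ)..(2 * Real.pi),
        modeParam σ n σ (lightCone ℓ t φ σ) * (L σ (lightCone ℓ t φ σ) : ℂ)

/-- `δ_e Q = d` at `L`, where `δ_e` is extended complex linearly to complex parameters `e`; the
derivatives are required to exist. -/
def HasVariation (e : Sector → ℝ → ℂ) (Q : Fields → ℂ) (L : Fields) (d : ℂ) : Prop :=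
  ∃ a b : ℂ,
    HasDerivAt (fun s : ℝ => Q (L + s • deltaL (fun σ x => (e σ x).re) L)) a 0 ∧
    HasDerivAt (fun s : ℝ => Q (L + s • deltaL (fun σ x => (e σ x).im) L)) b 0 ∧
    d = a + Complex.I * b

/-- The bracket `{Q_{χ(e)}, Q} = - δ_e Q` has the value `d` at `L`. -/
def HasChargeBracket (e : Sector → ℝ → ℂ) (Q : Fields → ℂ) (L : Fields) (d : ℂ) : Prop :=
  HasVariation e Q L (-d)

/-! ### Virasoro coadjoint orbits -/

/-- (A lift to the line of) an orientation preserving diffeomorphism of the circle. -/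
structure IsCircleDiffeo (h : ℝ → ℝ) : Prop where
  smooth : ContDiff ℝ ∞ h
  deriv_pos : ∀ x, 0 < deriv h x
  equivariant : ∀ x, h (x + 2 * Real.pi) = h x + 2 * Real.pi

/-- The Schwarz derivative. -/
def schwarzian (h : ℝ → ℝ) (x : ℝ) : ℝ :=
  iteratedDeriv 3 h x / deriv h x - 3 * iteratedDeriv 2 h x ^ 2 / (2 * deriv h x ^ 2)

/-- The coadjoint action `h'² f(h) - S[h] / 2`. -/
def coadjointAction (h f : ℝ → ℝ) (x : ℝ) : ℝ :=
  deriv h x ^ 2 * f (h x) - schwarzian h x / 2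

end Banados

end

/-!
Everything is reduced to Hill's equation `ψ'' = f ψ` in one chiral sector.

*Hill's equation.* The fundamental solutions `y₁, y₂` (`hillSol f 1 0`, `hillSol f 0 1`) are given by
the Picard series, and variation of constants expresses the derivative of a solution along a family
of potentials by solutions and by the derivative of the family; hence solutions depend smoothly on
parameters (`contDiff_hillSol`). The stabilizer equation `k''' - 4 f k' - 2 k f' = 0` is solved
exactly by the quadratic forms in `y₁, y₂` (`isStabilizer_hillForm`,
`IsStabilizer.exists_eq_hillForm`), and a binary form splits over `ℂ`, so that each solution is a
product of two solutions of Hill's equation. A solution is periodic if and only if its form is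
invariant under the monodromy matrix `M`. The traceless part of `M` provides such a form, the
periodic solution `monodromyStabilizer f`. It is unique up to a factor unless it vanishes; in that
case `M = ± 1` and the potential `f` is exceptional.

*The charge.* Variation of constants shows that `monodromyStabilizer f` is the gradient of the trace
of `M` (`hasDerivAt_monodromyTrace`). The trace is an invariant of the coadjoint action, solutions of
Hill's equation being densities of weight `-1/2` (`monodromyTrace_coadjointAction`). On the constants
`c ≥ 0` it is increasing in `c` with derivative greater than `1`, so that a smooth function
`orbitLabel`, without critical points, recovers `c` from it. The charge is
`J(f) = ℓ / (4 G) * orbitLabel (monodromyTrace f)`, and the function `K(f)` (`orbitStabilizer`) is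
its gradient up to the factor `ℓ / (8 π G)`; by construction `K(c) = 1`. Thus `J` is constant on the
orbits, and the second variation of `J` is symmetric because `J` is smooth along every plane of
potentials. An infinitesimal coadjoint variation is orthogonal to every periodic stabilizer after an
integration by parts (`integral_stabilizer_mul_coadjointVariation`), which makes the charges
commute.

*The geometry.* The Lie derivative of the metric along `χ(ε; L)` is the variation of the metric under
`δ_ε L` (`lieDerivative_metric_chi`), so that Killing vectors correspond to stabilizers. The
commutator of `χ(ε; L)` with a Killing vector `χ(κ; L)` is the variation of `χ(κ; L)` under which `L`
changes by `δ_ε L` and `κ` by its Lie bracket with `ε` on the line (`lieBracket_chi`). The adjusted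
bracket of `χ(ε; L)` and `ζ_±` therefore vanishes as soon as `K` is equivariant, that is, as soon as
the coadjoint action of `ε` changes `K(f)` by `ε K' - ε' K` (`hasDerivAt_orbitStabilizer_coadjoint`).
-/

noncomputable section

namespace Banados

open MeasureTheory Filter Topology Set

/-! ### Integrals depending smoothly on parameters -/

theorem contDiff_fderiv_left {X V : Type} [NormedAddCommGroup X] [NormedSpace ℝ X]
    [NormedAddCommGroup V] [NormedSpace ℝ V] {n : ℕ} {G : X → ℝ → V}
    (hG : ContDiff ℝ (n + 1) (Function.uncurry G)) :
    ContDiff ℝ n (Function.uncurry fun p τ => fderiv ℝ (fun q => G q τ) p) := by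
  have h : ContDiff ℝ (n + 1) (Function.uncurry fun (q : X × ℝ) (p : X) => G p q.2) :=
    hG.comp (contDiff_snd.prodMk (contDiff_snd.comp contDiff_fst))
  exact h.fderiv_succ contDiff_fst

theorem hasFDerivAt_parametric_integral {X V : Type} [NormedAddCommGroup X] [NormedSpace ℝ X]
    [FiniteDimensional ℝ X] [NormedAddCommGroup V] [NormedSpace ℝ V]
    {G : X → ℝ → V} (hG : ContDiff ℝ 1 (Function.uncurry G)) (a b : ℝ) (p : X) :
    HasFDerivAt (fun q => ∫ τ in a..b, G q τ)
      (∫ τ in a..b, fderiv ℝ (fun q => G q τ) p) p := by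
  have hG' : Continuous (Function.uncurry fun p τ => fderiv ℝ (fun q => G q τ) p) := by
    have := contDiff_fderiv_left (n := 0) (G := G) (by simpa using hG)
    exact this.continuous
  have hc : ∀ q, Continuous (G q) := fun q =>
    hG.continuous.comp (continuous_const.prodMk continuous_id)
  obtain ⟨M, hM⟩ := ((isCompact_closedBall p 1).prod (isCompact_uIcc (a := a) (b := b))
    ).exists_bound_of_continuousOn hG'.continuousOn
  refine intervalIntegral.hasFDerivAt_integral_of_dominated_of_fderiv_le (bound := fun _ => M)
    (Metric.closedBall_mem_nhds p one_pos) (.of_forall fun q => (hc q).aestronglyMeasurable)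
    ((hc p).intervalIntegrable _ _)
    (hG'.comp (continuous_const.prodMk continuous_id)).aestronglyMeasurable
    (.of_forall fun τ hτ q hq => hM (q, τ) ⟨hq, uIoc_subset_uIcc hτ⟩) (by simp)
    (.of_forall fun τ hτ q hq => ?_)
  have hd : DifferentiableAt ℝ (fun q => G q τ) q :=
    (hG.comp (contDiff_id.prodMk contDiff_const)).differentiable (by simp) q
  exact hd.hasFDerivAt

theorem contDiff_nat_parametric_integral {X : Type} [NormedAddCommGroup X] [NormedSpace ℝ X]
    [FiniteDimensional ℝ X] (n : ℕ) (a b : ℝ) :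
    ∀ {V : Type} [NormedAddCommGroup V] [NormedSpace ℝ V] {G : X → ℝ → V},
    ContDiff ℝ n (Function.uncurry G) → ContDiff ℝ n fun q => ∫ τ in a..b, G q τ := by
  induction n with
  | zero =>
    intro V _ _ G hG
    simp only [Nat.cast_zero, contDiff_zero] at hG ⊢
    exact intervalIntegral.continuous_parametric_intervalIntegral_of_continuous' hG a b
  | succ n ih =>
    intro V _ _ G hG
    push_cast at hG ⊢
    have h1 := fun p => hasFDerivAt_parametric_integral (hG.of_le (by simp)) a b p
    refine contDiff_succ_iff_fderiv.2 ⟨fun p => (h1 p).differentiableAt, by simp, ?_⟩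
    rw [funext fun p => (h1 p).fderiv]
    exact ih (contDiff_fderiv_left hG)

/-- A primitive `∫_0^x G(s, z) dz` is as smooth in `(s, x)` as the integrand is in `(s, z)`. -/
theorem contDiff_nat_primitive {E V : Type} [NormedAddCommGroup E] [NormedSpace ℝ E]
    [FiniteDimensional ℝ E] [NormedAddCommGroup V] [NormedSpace ℝ V] {n : ℕ} {G : E → ℝ → V}
    (hG : ContDiff ℝ n (Function.uncurry G)) :
    ContDiff ℝ n (Function.uncurry fun s x => ∫ z in (0 : ℝ)..x, G s z) := by
  have h : (Function.uncurry fun s x => ∫ z in (0 : ℝ)..x, G s z)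
      = fun p : E × ℝ => p.2 • ∫ τ in (0 : ℝ)..1, G p.1 (p.2 * τ) := by
    ext ⟨s, x⟩
    simp [Function.uncurry, intervalIntegral.smul_integral_comp_mul_left (f := G s)]
  rw [h]
  refine contDiff_snd.smul (contDiff_nat_parametric_integral n 0 1
    (G := fun (p : E × ℝ) τ => G p.1 (p.2 * τ)) ?_)
  exact hG.comp ((contDiff_fst.comp contDiff_fst).prodMk
    ((contDiff_snd.comp contDiff_fst).mul contDiff_snd))

/-- Differentiation of `s ↦ ∫_a^b g(s, z) (F(s, z) - F(s₀, z)) dz` at `s₀`, for a factor `g` which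
is merely continuous. -/
theorem hasFDerivAt_integral_mul_sub {E : Type} [NormedAddCommGroup E] [NormedSpace ℝ E]
    [FiniteDimensional ℝ E] {g F : E → ℝ → ℝ} (hg : Continuous (Function.uncurry g))
    (hF : ContDiff ℝ 1 (Function.uncurry F)) (a b : ℝ) (s₀ : E) :
    HasFDerivAt (fun s => ∫ z in a..b, g s z * (F s z - F s₀ z))
      (∫ z in a..b, g s₀ z • fderiv ℝ (fun s => F s z) s₀) s₀ := by
  have hF' : Continuous (Function.uncurry fun p τ => fderiv ℝ (fun q => F q τ) p) := by
    have := contDiff_fderiv_left (n := 0) (G := F) (by simpa using hF)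
    exact this.continuous
  have hc : ∀ q, Continuous (F q) := fun q =>
    hF.continuous.comp (continuous_const.prodMk continuous_id)
  have hgc : ∀ q, Continuous (g q) := fun q => hg.comp (continuous_const.prodMk continuous_id)
  have hd : ∀ z q, HasFDerivAt (fun q => F q z) (fderiv ℝ (fun q => F q z) q) q := fun z q =>
    ((hF.comp (contDiff_id.prodMk contDiff_const)).differentiable (by simp) q).hasFDerivAt
  have hK := (isCompact_closedBall s₀ 1).prod (isCompact_uIcc (a := a) (b := b))
  obtain ⟨M, hM⟩ := hK.exists_bound_of_continuousOn hF'.continuousOn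
  obtain ⟨N, hN⟩ := hK.exists_bound_of_continuousOn hg.continuousOn
  simp only [intervalIntegral.intervalIntegral_eq_integral_uIoc]
  refine HasFDerivAt.const_smul (c := if a ≤ b then (1 : ℝ) else -1)
    (hasFDerivAt_integral_of_dominated_loc_of_lip'
    (F := fun s z => g s z * (F s z - F s₀ z)) (bound := fun _ => N * M)
    (Metric.closedBall_mem_nhds s₀ one_pos)
    (fun q _ => ((hgc q).mul ((hc q).sub (hc s₀))).aestronglyMeasurable) ?_
    ((hgc s₀).smul (hF'.comp (continuous_const.prodMk continuous_id))).aestronglyMeasurable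
    ?_ ?_ ?_).2
  · simp
  · refine (ae_restrict_iff' measurableSet_uIoc).2 (.of_forall fun z hz s hs => ?_)
    have hz' := uIoc_subset_uIcc hz
    simp only [sub_self, mul_zero, sub_zero, norm_mul]
    have h1 : ‖F s z - F s₀ z‖ ≤ M * ‖s - s₀‖ :=
      (convex_closedBall s₀ 1).norm_image_sub_le_of_norm_hasFDerivWithin_le
        (fun q _ => (hd z q).hasFDerivWithinAt) (fun q hq => hM (q, z) ⟨hq, hz'⟩)
        (Metric.mem_closedBall_self zero_le_one) hs
    rw [mul_assoc]
    exact mul_le_mul (hN (s, z) ⟨hs, hz'⟩) h1 (norm_nonneg _)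
      ((norm_nonneg _).trans (hN (s, z) ⟨hs, hz'⟩))
  · have : IntervalIntegrable (fun _ : ℝ => N * M) volume a b := by simp
    exact intervalIntegrable_iff.1 this
  · refine .of_forall fun z => ?_
    have h1 : HasFDerivAt (fun s => (g s z - g s₀ z) * (F s z - F s₀ z)) (0 : E →L[ℝ] ℝ) s₀ := by
      have hlit : (fun s => g s z - g s₀ z) =o[𝓝 s₀] fun _ => (1 : ℝ) := by
        rw [Asymptotics.isLittleO_one_iff]
        have : Continuous fun s => g s z - g s₀ z :=
          (hg.comp (continuous_id.prodMk continuous_const)).sub continuous_const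
        simpa using this.tendsto s₀
      refine .of_isLittleO ?_
      have := hlit.mul_isBigO (hd z s₀).isBigO_sub.norm_right
      simpa using this
    have h2 := h1.add (((hd z s₀).sub_const (F s₀ z)).const_mul (g s₀ z))
    refine (h2.congr_of_eventuallyEq (.of_forall fun s => ?_)).congr_fderiv (by simp)
    simp only [Pi.add_apply]
    ring

/-! ### Solutions of Hill's equation by Picard iteration -/

/-- The Picard iterates of `ψ'' = f ψ`, `ψ(0) = a`, `ψ'(0) = b`. The operator
`ψ ↦ ∫_0^x (x - z) f(z) ψ(z) dz` is written as an integral over `[0, 1]`, so that both signs of `x`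
are treated alike. -/
def hillIter (f : ℝ → ℝ) (a b : ℝ) : ℕ → ℝ → ℝ
  | 0 => fun x => a + b * x
  | n + 1 => fun x => x ^ 2 * ∫ τ in (0 : ℝ)..1, (1 - τ) * f (x * τ) * hillIter f a b n (x * τ)

/-- The solution of Hill's equation `ψ'' = f ψ` with `ψ(0) = a`, `ψ'(0) = b`. -/
def hillSol (f : ℝ → ℝ) (a b x : ℝ) : ℝ := ∑' n, hillIter f a b n x

/-- The derivative of `hillSol f a b`. -/
def hillVel (f : ℝ → ℝ) (a b x : ℝ) : ℝ := b + ∫ z in (0 : ℝ)..x, f z * hillSol f a b z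

theorem continuous_hillIter {E : Type} [TopologicalSpace E] [FirstCountableTopology E]
    {F : E → ℝ → ℝ} (hF : Continuous (Function.uncurry F)) (a b : ℝ) (n : ℕ) :
    Continuous (Function.uncurry fun s => hillIter (F s) a b n) := by
  induction n with
  | zero =>
    change Continuous fun p : E × ℝ => a + b * p.2
    fun_prop
  | succ n ih =>
    change Continuous fun p : E × ℝ => p.2 ^ 2 * ∫ τ in (0 : ℝ)..1,
      (1 - τ) * F p.1 (p.2 * τ) * hillIter (F p.1) a b n (p.2 * τ)
    refine (continuous_snd.pow 2).mul
      (intervalIntegral.continuous_parametric_intervalIntegral_of_continuous' ?_ 0 1)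
    have hc : Continuous fun q : (E × ℝ) × ℝ => (q.1.1, q.1.2 * q.2) := by fun_prop
    exact ((continuous_const.sub continuous_snd).mul (hF.comp hc)).mul (ih.comp hc)

theorem continuous_hillIter_right {f : ℝ → ℝ} (hf : Continuous f) (a b : ℝ) (n : ℕ) :
    Continuous (hillIter f a b n) :=
  (continuous_hillIter (F := fun _ : Unit => f) (hf.comp continuous_snd) a b n).comp
    (continuous_const.prodMk continuous_id : Continuous fun x : ℝ => ((), x))

theorem abs_hillIter_le {f : ℝ → ℝ} (a b : ℝ) {M R : ℝ}
    (hM : ∀ z, |z| ≤ R → |f z| ≤ M) (n : ℕ) :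
    ∀ x, |x| ≤ R → |hillIter f a b n x| ≤ (|a| + |b| * R) * ((M * R ^ 2) ^ n / n.factorial) := by
  have key : ∀ n x, |x| ≤ R →
      |hillIter f a b n x| ≤ (|a| + |b| * R) * ((M * x ^ 2) ^ n / n.factorial) := by
    intro n
    induction n with
    | zero =>
      intro x hx
      simp only [hillIter, pow_zero, Nat.factorial_zero, Nat.cast_one, div_one, mul_one]
      refine (abs_add_le _ _).trans ?_
      rw [abs_mul]
      gcongr
    | succ n ih =>
      intro x hx
      have hR : 0 ≤ R := (abs_nonneg x).trans hx
      have hM0 : 0 ≤ M := (abs_nonneg _).trans (hM x hx)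
      have hb : ∀ τ ∈ Icc (0 : ℝ) 1, |(1 - τ) * f (x * τ) * hillIter f a b n (x * τ)|
          ≤ (M * (|a| + |b| * R) * ((M * x ^ 2) ^ n / n.factorial)) * τ ^ n := by
        rintro τ ⟨h0, h1⟩
        have hxτ : |x * τ| ≤ R := by
          rw [abs_mul, abs_of_nonneg h0]
          exact (mul_le_of_le_one_right (abs_nonneg x) h1).trans hx
        have h2 : |1 - τ| ≤ 1 := by rw [abs_of_nonneg (by linarith)]; linarith
        rw [abs_mul, abs_mul]
        calc |1 - τ| * |f (x * τ)| * |hillIter f a b n (x * τ)|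
            ≤ 1 * M * ((|a| + |b| * R) * ((M * (x * τ) ^ 2) ^ n / n.factorial)) := by
              gcongr
              · exact hM _ hxτ
              · exact ih _ hxτ
          _ = (M * (|a| + |b| * R) * ((M * x ^ 2) ^ n / n.factorial)) * (τ ^ n * τ ^ n) := by
              rw [show M * (x * τ) ^ 2 = M * x ^ 2 * (τ * τ) by ring, mul_pow, mul_pow τ τ]
              ring
          _ ≤ _ := by
              gcongr
              exact mul_le_of_le_one_right (by positivity) (pow_le_one₀ h0 h1)
      have hi : |∫ τ in (0 : ℝ)..1, (1 - τ) * f (x * τ) * hillIter f a b n (x * τ)|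
          ≤ ∫ τ in (0 : ℝ)..1, (M * (|a| + |b| * R) * ((M * x ^ 2) ^ n / n.factorial)) * τ ^ n := by
        rw [← Real.norm_eq_abs]
        exact intervalIntegral.norm_integral_le_of_norm_le zero_le_one
          (.of_forall fun τ hτ => hb τ ⟨hτ.1.le, hτ.2⟩)
          (Continuous.intervalIntegrable (by fun_prop) _ _)
      rw [intervalIntegral.integral_const_mul, integral_pow] at hi
      change |x ^ 2 * _| ≤ _
      rw [abs_mul, abs_of_nonneg (sq_nonneg x)]
      refine (mul_le_mul_of_nonneg_left hi (sq_nonneg x)).trans (le_of_eq ?_)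
      rw [Nat.factorial_succ]
      have : (n.factorial : ℝ) ≠ 0 := by positivity
      have : (n : ℝ) + 1 ≠ 0 := by positivity
      push_cast
      simp only [one_pow, ne_eq, n.succ_ne_zero, not_false_eq_true, zero_pow, sub_zero]
      field_simp
      ring
  intro x hx
  have hR : 0 ≤ R := (abs_nonneg x).trans hx
  have hM0 : 0 ≤ M := (abs_nonneg _).trans (hM x hx)
  refine (key n x hx).trans ?_
  have : x ^ 2 ≤ R ^ 2 := sq_le_sq' (by linarith [neg_abs_le x]) ((le_abs_self x).trans hx)
  gcongr

theorem exists_abs_le_of_continuous {f : ℝ → ℝ} (hf : Continuous f) (R : ℝ) :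
    ∃ M, ∀ z, |z| ≤ R → |f z| ≤ M := by
  obtain ⟨M, hM⟩ := (isCompact_Icc (a := -R) (b := R)).exists_bound_of_continuousOn hf.continuousOn
  exact ⟨M, fun z hz => hM z (abs_le.1 hz)⟩

theorem summable_hillIter_bound (a b M R : ℝ) :
    Summable fun n : ℕ => (|a| + |b| * R) * ((M * R ^ 2) ^ n / n.factorial) :=
  (Real.summable_pow_div_factorial _).mul_left _

theorem hasSum_hillIter {f : ℝ → ℝ} (hf : Continuous f) (a b x : ℝ) :
    HasSum (fun n => hillIter f a b n x) (hillSol f a b x) := by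
  obtain ⟨M, hM⟩ := exists_abs_le_of_continuous hf |x|
  exact (Summable.of_norm_bounded (summable_hillIter_bound a b M |x|)
    fun n => abs_hillIter_le a b hM n x le_rfl).hasSum

theorem continuous_hillSol {E : Type} [NormedAddCommGroup E] [NormedSpace ℝ E]
    [FiniteDimensional ℝ E] {F : E → ℝ → ℝ} (hF : Continuous (Function.uncurry F)) (a b : ℝ) :
    Continuous (Function.uncurry fun s => hillSol (F s) a b) := by
  have hFs : ∀ s, Continuous (F s) := fun s => hF.comp (continuous_const.prodMk continuous_id)
  refine continuous_iff_continuousAt.2 fun ⟨s₀, x₀⟩ => ?_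
  set R := |x₀| + 1
  obtain ⟨M, hM⟩ := ((isCompact_closedBall s₀ 1).prod
    (isCompact_Icc (a := -R) (b := R))).exists_bound_of_continuousOn hF.continuousOn
  have hcont : ContinuousOn (Function.uncurry fun s => hillSol (F s) a b)
      (Metric.closedBall s₀ 1 ×ˢ Icc (-R) R) :=
    continuousOn_tsum (fun n => (continuous_hillIter hF a b n).continuousOn)
      (summable_hillIter_bound a b M R) fun n p hp => abs_hillIter_le a b
        (fun z hz => hM (p.1, z) ⟨hp.1, abs_le.1 hz⟩) n p.2 (abs_le.2 hp.2)
  refine hcont.continuousAt (prod_mem_nhds (Metric.closedBall_mem_nhds s₀ one_pos) ?_)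
  exact Icc_mem_nhds (by linarith [neg_abs_le x₀]) (by linarith [le_abs_self x₀])

theorem continuous_hillSol_right {f : ℝ → ℝ} (hf : Continuous f) (a b : ℝ) :
    Continuous (hillSol f a b) :=
  (continuous_hillSol (F := fun _ : ℝ => f) (hf.comp continuous_snd) a b).comp
    (continuous_const.prodMk continuous_id : Continuous fun x : ℝ => ((0 : ℝ), x))

/-- Hill's equation in integrated form. -/
theorem hillSol_eq_integral {f : ℝ → ℝ} (hf : Continuous f) (a b x : ℝ) :
    hillSol f a b x = a + b * x + (x * (∫ z in (0 : ℝ)..x, f z * hillSol f a b z)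
      - ∫ z in (0 : ℝ)..x, z * (f z * hillSol f a b z)) := by
  have hy := continuous_hillSol_right hf a b
  obtain ⟨M, hM⟩ := exists_abs_le_of_continuous hf |x|
  have hM0 : 0 ≤ M := (abs_nonneg _).trans (hM x le_rfl)
  have hsum : HasSum (fun n => hillIter f a b (n + 1) x)
      (x ^ 2 * ∫ τ in (0 : ℝ)..1, (1 - τ) * f (x * τ) * hillSol f a b (x * τ)) := by
    refine HasSum.mul_left _ (intervalIntegral.hasSum_integral_of_dominated_convergence
      (fun n _ => M * ((|a| + |b| * |x|) * ((M * |x| ^ 2) ^ n / n.factorial)))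
      (fun n => ?_) (fun n => .of_forall fun τ hτ => ?_) (.of_forall fun τ _ =>
        (summable_hillIter_bound a b M |x|).mul_left _) (by simp)
      (.of_forall fun τ _ => (hasSum_hillIter hf a b (x * τ)).mul_left _))
    · have := continuous_hillIter_right hf a b n
      exact Continuous.aestronglyMeasurable (by fun_prop)
    · rw [uIoc_of_le zero_le_one] at hτ
      have hxτ : |x * τ| ≤ |x| := by
        rw [abs_mul, abs_of_pos hτ.1]
        exact mul_le_of_le_one_right (abs_nonneg x) hτ.2
      have h2 : |1 - τ| ≤ 1 := by
        rw [abs_of_nonneg (by linarith [hτ.2])]; linarith [hτ.1]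
      rw [Real.norm_eq_abs, abs_mul, abs_mul]
      refine mul_le_mul ?_ (abs_hillIter_le a b hM n _ hxτ) (abs_nonneg _) hM0
      calc |1 - τ| * |f (x * τ)| ≤ 1 * M := by
            gcongr
            exact hM _ hxτ
        _ = M := one_mul M
  have h0 : hillSol f a b x = a + b * x
      + x ^ 2 * ∫ τ in (0 : ℝ)..1, (1 - τ) * f (x * τ) * hillSol f a b (x * τ) := by
    rw [← hsum.tsum_eq]
    exact (hasSum_hillIter hf a b x).summable.tsum_eq_zero_add
  have h1 : x ^ 2 * ∫ τ in (0 : ℝ)..1, (1 - τ) * f (x * τ) * hillSol f a b (x * τ)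
      = ∫ z in (0 : ℝ)..x, (x - z) * (f z * hillSol f a b z) := by
    have := intervalIntegral.smul_integral_comp_mul_left (a := 0) (b := 1)
      (f := fun z => (x - z) * (f z * hillSol f a b z)) x
    simp only [mul_zero, mul_one, smul_eq_mul] at this
    rw [← this, sq, mul_assoc, ← intervalIntegral.integral_const_mul x]
    congr 2
    ext τ
    ring
  conv_lhs => rw [h0, h1]
  rw [← intervalIntegral.integral_const_mul, ← intervalIntegral.integral_sub]
  · congr 2
    ext z
    ring
  · exact Continuous.intervalIntegrable (by fun_prop) _ _
  · exact Continuous.intervalIntegrable (by fun_prop) _ _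

theorem hasDerivAt_hillSol {f : ℝ → ℝ} (hf : Continuous f) (a b x : ℝ) :
    HasDerivAt (hillSol f a b) (hillVel f a b x) x := by
  have hy := continuous_hillSol_right hf a b
  have hfy : Continuous fun z => f z * hillSol f a b z := hf.mul hy
  have hzfy : Continuous fun z => z * (f z * hillSol f a b z) := continuous_id.mul hfy
  have h1 := (hfy.integral_hasStrictDerivAt 0 x).hasDerivAt
  have h2 := (hzfy.integral_hasStrictDerivAt 0 x).hasDerivAt
  have h3 := (((hasDerivAt_id x).const_mul b).const_add a).add
    (((hasDerivAt_id x).mul h1).sub h2)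
  refine (h3.congr_of_eventuallyEq (.of_forall fun z => hillSol_eq_integral hf a b z)).congr_deriv ?_
  simp only [hillVel, id_eq, one_mul, mul_one]
  ring

theorem hasDerivAt_hillVel {f : ℝ → ℝ} (hf : Continuous f) (a b x : ℝ) :
    HasDerivAt (hillVel f a b) (f x * hillSol f a b x) x :=
  ((hf.mul (continuous_hillSol_right hf a b)).integral_hasStrictDerivAt 0 x).hasDerivAt.const_add b

theorem hillSol_zero {f : ℝ → ℝ} (hf : Continuous f) (a b : ℝ) : hillSol f a b 0 = a := by
  rw [hillSol_eq_integral hf]; simp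

theorem hillVel_zero (f : ℝ → ℝ) (a b : ℝ) : hillVel f a b 0 = b := by
  simp [hillVel]

/-- For a nonnegative potential, all Picard iterates of the second fundamental solution are
nonnegative on the right half-line, so the solution is bounded below by the first of them. -/
theorem le_hillSol_of_nonneg {f : ℝ → ℝ} (hf : Continuous f) (hf0 : ∀ x, 0 ≤ f x) {x : ℝ}
    (hx : 0 ≤ x) : x ≤ hillSol f 0 1 x := by
  have h0 : ∀ n x, 0 ≤ x → 0 ≤ hillIter f 0 1 n x := by
    intro n
    induction n with
    | zero => intro x hx; simpa [hillIter] using hx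
    | succ n ih =>
      intro x hx
      refine mul_nonneg (sq_nonneg x) (intervalIntegral.integral_nonneg zero_le_one ?_)
      exact fun τ hτ => mul_nonneg (mul_nonneg (by linarith [hτ.2]) (hf0 _))
        (ih _ (mul_nonneg hx hτ.1))
  have := le_hasSum (hasSum_hillIter hf 0 1 x) 0 fun n _ => h0 n x hx
  simpa [hillIter] using this

/-! ### Wronskians and variation of constants -/

/-- `y` is a real solution of `y'' = f y + g`, with derivative `v`. -/
structure IsForcedHillPair (f g y v : ℝ → ℝ) : Prop where
  pos : ∀ x, HasDerivAt y (v x) x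
  vel : ∀ x, HasDerivAt v (f x * y x + g x) x

theorem isForcedHillPair_hillSol {f : ℝ → ℝ} (hf : Continuous f) (a b : ℝ) :
    IsForcedHillPair f 0 (hillSol f a b) (hillVel f a b) :=
  ⟨hasDerivAt_hillSol hf a b, fun x => by simpa using hasDerivAt_hillVel hf a b x⟩

theorem eq_integral_of_hasDerivAt {W w : ℝ → ℝ} (hW : ∀ x, HasDerivAt W (w x) x)
    (hw : Continuous w) (x : ℝ) : W x = W 0 + ∫ z in (0 : ℝ)..x, w z := by
  rw [intervalIntegral.integral_eq_sub_of_hasDerivAt (fun z _ => hW z) (hw.intervalIntegrable _ _)]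
  ring

theorem hill_wronskian {f : ℝ → ℝ} (hf : Continuous f) (x : ℝ) :
    hillSol f 1 0 x * hillVel f 0 1 x - hillVel f 1 0 x * hillSol f 0 1 x = 1 := by
  have h := eq_integral_of_hasDerivAt (w := 0) (W := fun x =>
    hillSol f 1 0 x * hillVel f 0 1 x - hillVel f 1 0 x * hillSol f 0 1 x) (fun x => by
      refine (((hasDerivAt_hillSol hf 1 0 x).mul (hasDerivAt_hillVel hf 0 1 x)).sub
        ((hasDerivAt_hillVel hf 1 0 x).mul (hasDerivAt_hillSol hf 0 1 x))).congr_deriv ?_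
      simp only [Pi.zero_apply]; ring) continuous_zero x
  simpa [hillSol_zero hf, hillVel_zero] using h

/-- Variation of constants: the Wronskians of a solution of `y'' = f y + g` with the fundamental
solutions are primitives. -/
theorem IsForcedHillPair.wronskian_eq {f g y v : ℝ → ℝ} (hf : Continuous f) (hg : Continuous g)
    (h : IsForcedHillPair f g y v) (x : ℝ) :
    hillSol f 1 0 x * v x - hillVel f 1 0 x * y x
        = v 0 + ∫ z in (0 : ℝ)..x, hillSol f 1 0 z * g z ∧
    hillSol f 0 1 x * v x - hillVel f 0 1 x * y x
        = - y 0 + ∫ z in (0 : ℝ)..x, hillSol f 0 1 z * g z := by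
  have key : ∀ a b, hillSol f a b x * v x - hillVel f a b x * y x
      = (a * v 0 - b * y 0) + ∫ z in (0 : ℝ)..x, hillSol f a b z * g z := by
    intro a b
    have h1 := eq_integral_of_hasDerivAt (w := fun x => hillSol f a b x * g x) (W := fun x =>
      hillSol f a b x * v x - hillVel f a b x * y x) (fun x => by
        refine (((hasDerivAt_hillSol hf a b x).mul (h.vel x)).sub
          ((hasDerivAt_hillVel hf a b x).mul (h.pos x))).congr_deriv ?_
        ring) ((continuous_hillSol_right hf a b).mul hg) x
    simpa [hillSol_zero hf, hillVel_zero] using h1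
  exact ⟨by simpa using key 1 0, by simpa using key 0 1⟩

theorem IsForcedHillPair.eq_variation {f g y v : ℝ → ℝ} (hf : Continuous f) (hg : Continuous g)
    (h : IsForcedHillPair f g y v) (x : ℝ) :
    y x = y 0 * hillSol f 1 0 x + v 0 * hillSol f 0 1 x
        + (hillSol f 0 1 x * (∫ z in (0 : ℝ)..x, hillSol f 1 0 z * g z)
          - hillSol f 1 0 x * ∫ z in (0 : ℝ)..x, hillSol f 0 1 z * g z) ∧
    v x = y 0 * hillVel f 1 0 x + v 0 * hillVel f 0 1 x
        + (hillVel f 0 1 x * (∫ z in (0 : ℝ)..x, hillSol f 1 0 z * g z)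
          - hillVel f 1 0 x * ∫ z in (0 : ℝ)..x, hillSol f 0 1 z * g z) := by
  obtain ⟨h1, h2⟩ := h.wronskian_eq hf hg x
  have h3 := hill_wronskian hf x
  constructor
  · linear_combination (-y x) * h3 + hillSol f 0 1 x * h1 - hillSol f 1 0 x * h2
  · linear_combination (-v x) * h3 + hillVel f 0 1 x * h1 - hillVel f 1 0 x * h2

theorem IsForcedHillPair.eq_fundamental {f y v : ℝ → ℝ} (hf : Continuous f)
    (h : IsForcedHillPair f 0 y v) (x : ℝ) :
    y x = y 0 * hillSol f 1 0 x + v 0 * hillSol f 0 1 x ∧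
    v x = y 0 * hillVel f 1 0 x + v 0 * hillVel f 0 1 x := by
  simpa using h.eq_variation hf continuous_zero x

/-! ### Dependence of the solutions on the potential -/

section Dependence

variable {E : Type} [NormedAddCommGroup E] [NormedSpace ℝ E] [FiniteDimensional ℝ E]
  {F : E → ℝ → ℝ}

/-- The Wronskian primitive which governs the first variation of a solution: the derivative of
`∫_0^x y_j(s₀) (F(s) - F(s₀)) y(s)` with respect to `s`. -/
def hillVariation (F : E → ℝ → ℝ) (c d a b : ℝ) (s : E) (x : ℝ) : E →L[ℝ] ℝ :=
  ∫ z in (0 : ℝ)..x, (hillSol (F s) c d z * hillSol (F s) a b z) • fderiv ℝ (fun s => F s z) s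

theorem hasFDerivAt_hillSol_param (hF : ContDiff ℝ 1 (Function.uncurry F)) (a b : ℝ) (s : E)
    (x : ℝ) :
    HasFDerivAt (fun s => hillSol (F s) a b x)
      (hillSol (F s) 0 1 x • hillVariation F 1 0 a b s x
        - hillSol (F s) 1 0 x • hillVariation F 0 1 a b s x) s ∧
    HasFDerivAt (fun s => hillVel (F s) a b x)
      (hillVel (F s) 0 1 x • hillVariation F 1 0 a b s x
        - hillVel (F s) 1 0 x • hillVariation F 0 1 a b s x) s := by
  have hFs : ∀ s, Continuous (F s) := fun s =>
    hF.continuous.comp (continuous_const.prodMk continuous_id)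
  have hy : Continuous (Function.uncurry fun s => hillSol (F s) a b) :=
    continuous_hillSol hF.continuous a b
  have hW : ∀ c d, HasFDerivAt (fun s' => ∫ z in (0 : ℝ)..x,
      hillSol (F s) c d z * ((F s' z - F s z) * hillSol (F s') a b z))
      (hillVariation F c d a b s x) s := by
    intro c d
    have := hasFDerivAt_integral_mul_sub
      (g := fun s' z => hillSol (F s) c d z * hillSol (F s') a b z)
      (((continuous_hillSol_right (hFs s) c d).comp continuous_snd).mul hy) hF 0 x s
    refine this.congr_of_eventuallyEq (.of_forall fun s' => ?_)
    refine intervalIntegral.integral_congr fun z _ => ?_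
    ring
  have hdiff : ∀ s', IsForcedHillPair (F s) (fun z => (F s' z - F s z) * hillSol (F s') a b z)
      (hillSol (F s') a b) (hillVel (F s') a b) := fun s' =>
    ⟨hasDerivAt_hillSol (hFs s') a b, fun x =>
      (hasDerivAt_hillVel (hFs s') a b x).congr_deriv (by ring)⟩
  have hvar := fun s' => (hdiff s').eq_variation (hFs s)
    (((hFs s').sub (hFs s)).mul (continuous_hillSol_right (hFs s') a b)) x
  simp only [hillSol_zero (hFs _), hillVel_zero] at hvar
  constructor
  · refine HasFDerivAt.congr_of_eventuallyEq ?_ (.of_forall fun s' => (hvar s').1)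
    exact (((hW 1 0).const_mul _).sub ((hW 0 1).const_mul _)).const_add _
  · refine HasFDerivAt.congr_of_eventuallyEq ?_ (.of_forall fun s' => (hvar s').2)
    exact (((hW 1 0).const_mul _).sub ((hW 0 1).const_mul _)).const_add _

theorem contDiff_nat_hillVel {n : ℕ} (hF : ContDiff ℝ n (Function.uncurry F)) {a b : ℝ}
    (hy : ContDiff ℝ n (Function.uncurry fun s => hillSol (F s) a b)) :
    ContDiff ℝ n (Function.uncurry fun s => hillVel (F s) a b) :=
  contDiff_const.add (contDiff_nat_primitive (G := fun s z => F s z * hillSol (F s) a b z)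
    (hF.mul hy))

/-- Smooth dependence on parameters: by variation of constants the derivative of a solution
involves only solutions and the derivative of the potential, which allows an induction on the
order of differentiability. -/
theorem contDiff_nat_hillSol (n : ℕ) (hF : ContDiff ℝ n (Function.uncurry F)) :
    ∀ a b, ContDiff ℝ n (Function.uncurry fun s => hillSol (F s) a b) := by
  induction n with
  | zero =>
    intro a b
    simp only [Nat.cast_zero, contDiff_zero] at hF ⊢
    exact continuous_hillSol hF a b
  | succ n ih =>
    intro a b
    push_cast at hF ⊢
    have hFn : ContDiff ℝ n (Function.uncurry F) := hF.of_le (by simp)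
    have hF1 : ContDiff ℝ 1 (Function.uncurry F) := hF.of_le (by simp)
    have hFs : ∀ s, Continuous (F s) := fun s =>
      hF.continuous.comp (continuous_const.prodMk continuous_id)
    have hvar : ∀ c d, ContDiff ℝ n (Function.uncurry (hillVariation F c d a b)) := fun c d =>
      contDiff_nat_primitive (((ih hFn c d).mul (ih hFn a b)).smul (contDiff_fderiv_left hF))
    set D : E × ℝ → E × ℝ →L[ℝ] ℝ := fun p =>
      (hillSol (F p.1) 0 1 p.2 • hillVariation F 1 0 a b p.1 p.2
        - hillSol (F p.1) 1 0 p.2 • hillVariation F 0 1 a b p.1 p.2).coprod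
      (ContinuousLinearMap.toSpanSingleton ℝ (hillVel (F p.1) a b p.2)) with hD
    have hDn : ContDiff ℝ n D := by
      have h1 : ContDiff ℝ n fun p : E × ℝ =>
          hillSol (F p.1) 0 1 p.2 • hillVariation F 1 0 a b p.1 p.2
          - hillSol (F p.1) 1 0 p.2 • hillVariation F 0 1 a b p.1 p.2 :=
        ((ih hFn 0 1).smul (hvar 1 0)).sub ((ih hFn 1 0).smul (hvar 0 1))
      have h2 : ContDiff ℝ n fun p : E × ℝ => hillVel (F p.1) a b p.2 :=
        contDiff_nat_hillVel hFn (ih hFn a b)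
      have h3 : D = fun p => (hillSol (F p.1) 0 1 p.2 • hillVariation F 1 0 a b p.1 p.2
          - hillSol (F p.1) 1 0 p.2 • hillVariation F 0 1 a b p.1 p.2).comp
            (ContinuousLinearMap.fst ℝ E ℝ)
          + hillVel (F p.1) a b p.2 • ContinuousLinearMap.snd ℝ E ℝ := by
        ext p q <;> simp [hD]
      rw [h3]
      exact (h1.clm_comp contDiff_const).add (h2.smul contDiff_const)
    have hderiv : ∀ p, HasFDerivAt (Function.uncurry fun s => hillSol (F s) a b) (D p) p := by
      intro p
      have h1 : Continuous fun p : E × ℝ =>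
          hillSol (F p.1) 0 1 p.2 • hillVariation F 1 0 a b p.1 p.2
          - hillSol (F p.1) 1 0 p.2 • hillVariation F 0 1 a b p.1 p.2 :=
        (((ih hFn 0 1).smul (hvar 1 0)).sub ((ih hFn 1 0).smul (hvar 0 1))).continuous
      have h2 : Continuous fun p : E × ℝ =>
          ContinuousLinearMap.toSpanSingleton ℝ (hillVel (F p.1) a b p.2) :=
        (ContinuousLinearMap.toSpanSingletonCLE (𝕜 := ℝ) (E := ℝ)).continuous.comp
          (contDiff_nat_hillVel hFn (ih hFn a b)).continuous
      exact (hasStrictFDerivAt_uncurry_coprod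
        (f := fun s => hillSol (F s) a b)
        (f₁ := fun s x => hillSol (F s) 0 1 x • hillVariation F 1 0 a b s x
          - hillSol (F s) 1 0 x • hillVariation F 0 1 a b s x)
        (f₂ := fun s x => ContinuousLinearMap.toSpanSingleton ℝ (hillVel (F s) a b x))
        (.of_forall fun q => (hasFDerivAt_hillSol_param hF1 a b q.1 q.2).1)
        (.of_forall fun q => (hasDerivAt_hillSol (hFs q.1) a b q.2).hasFDerivAt)
        h1.continuousAt h2.continuousAt).hasFDerivAt
    refine contDiff_succ_iff_fderiv.2 ⟨fun p => (hderiv p).differentiableAt, by simp, ?_⟩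
    rw [funext fun p => (hderiv p).fderiv]
    exact hDn

theorem contDiff_hillSol (hF : ContDiff ℝ ∞ (Function.uncurry F)) (a b : ℝ) :
    ContDiff ℝ ∞ (Function.uncurry fun s => hillSol (F s) a b) :=
  contDiff_infty.2 fun n => contDiff_nat_hillSol n (contDiff_infty.1 hF n) a b

theorem contDiff_hillVel (hF : ContDiff ℝ ∞ (Function.uncurry F)) (a b : ℝ) :
    ContDiff ℝ ∞ (Function.uncurry fun s => hillVel (F s) a b) :=
  contDiff_infty.2 fun n => contDiff_nat_hillVel (contDiff_infty.1 hF n)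
    (contDiff_nat_hillSol n (contDiff_infty.1 hF n) a b)

end Dependence

/-! ### The stabilizer equation and the monodromy -/

theorem IsCircleField.continuous {f : ℝ → ℝ} (hf : IsCircleField f) : Continuous f :=
  hf.smooth.continuous

theorem contDiff_hillSol_right {f : ℝ → ℝ} (hf : ContDiff ℝ ∞ f) (a b : ℝ) :
    ContDiff ℝ ∞ (hillSol f a b) :=
  (contDiff_hillSol (F := fun _ : ℝ => f) (hf.comp contDiff_snd) a b).comp
    (contDiff_const.prodMk contDiff_id : ContDiff ℝ ∞ fun x : ℝ => ((0 : ℝ), x))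

/-- The quadratic form `α y₁² + β y₁ y₂ + γ y₂²` in the fundamental solutions. -/
def hillForm (f : ℝ → ℝ) (α β γ x : ℝ) : ℝ :=
  α * hillSol f 1 0 x ^ 2 + β * (hillSol f 1 0 x * hillSol f 0 1 x) + γ * hillSol f 0 1 x ^ 2

theorem iteratedDeriv_two_of_hasDerivAt {V : Type} [NormedAddCommGroup V] [NormedSpace ℝ V]
    {k k₁ k₂ : ℝ → V} (h₁ : ∀ x, HasDerivAt k (k₁ x) x)
    (h₂ : ∀ x, HasDerivAt k₁ (k₂ x) x) (x : ℝ) : iteratedDeriv 2 k x = k₂ x := by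
  rw [iteratedDeriv_succ, iteratedDeriv_one, funext fun x => (h₁ x).deriv, (h₂ x).deriv]

theorem iteratedDeriv_three_of_hasDerivAt {k k₁ k₂ k₃ : ℝ → ℝ} (h₁ : ∀ x, HasDerivAt k (k₁ x) x)
    (h₂ : ∀ x, HasDerivAt k₁ (k₂ x) x) (h₃ : ∀ x, HasDerivAt k₂ (k₃ x) x) (x : ℝ) :
    iteratedDeriv 3 k x = k₃ x := by
  rw [iteratedDeriv_succ, funext (iteratedDeriv_two_of_hasDerivAt h₁ h₂), (h₃ x).deriv]

theorem hasDerivAt_hillForm {f : ℝ → ℝ} (hf : Continuous f) (α β γ x : ℝ) :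
    HasDerivAt (hillForm f α β γ) (2 * α * (hillSol f 1 0 x * hillVel f 1 0 x)
      + β * (hillVel f 1 0 x * hillSol f 0 1 x + hillSol f 1 0 x * hillVel f 0 1 x)
      + 2 * γ * (hillSol f 0 1 x * hillVel f 0 1 x)) x := by
  have h1 := hasDerivAt_hillSol hf 1 0 x
  have h2 := hasDerivAt_hillSol hf 0 1 x
  refine ((((h1.pow 2).const_mul α).add ((h1.mul h2).const_mul β)).add
    ((h2.pow 2).const_mul γ)).congr_deriv ?_
  simp only [Nat.cast_ofNat, Nat.add_one_sub_one, pow_one]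
  ring

theorem hasDerivAt_hillForm_deriv {f : ℝ → ℝ} (hf : Continuous f) (α β γ x : ℝ) :
    HasDerivAt (fun x => 2 * α * (hillSol f 1 0 x * hillVel f 1 0 x)
      + β * (hillVel f 1 0 x * hillSol f 0 1 x + hillSol f 1 0 x * hillVel f 0 1 x)
      + 2 * γ * (hillSol f 0 1 x * hillVel f 0 1 x))
      (2 * (f x * hillForm f α β γ x) + 2 * (α * hillVel f 1 0 x ^ 2
        + β * (hillVel f 1 0 x * hillVel f 0 1 x) + γ * hillVel f 0 1 x ^ 2)) x := by
  have h1 := hasDerivAt_hillSol hf 1 0 x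
  have h2 := hasDerivAt_hillSol hf 0 1 x
  have h3 := hasDerivAt_hillVel hf 1 0 x
  have h4 := hasDerivAt_hillVel hf 0 1 x
  refine ((((h1.mul h3).const_mul (2 * α)).add (((h3.mul h2).add (h1.mul h4)).const_mul β)).add
    ((h2.mul h4).const_mul (2 * γ))).congr_deriv ?_
  simp only [hillForm]
  ring

theorem isStabilizer_hillForm {f : ℝ → ℝ} (hf : ContDiff ℝ ∞ f) (α β γ : ℝ) :
    IsStabilizer f (hillForm f α β γ) := by
  have hfc := hf.continuous
  have h1 := contDiff_hillSol_right hf 1 0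
  have h2 := contDiff_hillSol_right hf 0 1
  refine ⟨((contDiff_const.mul (h1.pow 2)).add (contDiff_const.mul (h1.mul h2))).add
    (contDiff_const.mul (h2.pow 2)), fun x => ?_⟩
  have hf' : ∀ x, HasDerivAt f (deriv f x) x := fun x => (hf.differentiable (by simp) x).hasDerivAt
  rw [iteratedDeriv_three_of_hasDerivAt (hasDerivAt_hillForm hfc α β γ)
    (hasDerivAt_hillForm_deriv hfc α β γ) (fun x =>
      (((hf' x).mul (hasDerivAt_hillForm hfc α β γ x)).const_mul 2).add
        (((((hasDerivAt_hillVel hfc 1 0 x).pow 2).const_mul α).add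
          (((hasDerivAt_hillVel hfc 1 0 x).mul (hasDerivAt_hillVel hfc 0 1 x)).const_mul β)).add
          (((hasDerivAt_hillVel hfc 0 1 x).pow 2).const_mul γ) |>.const_mul 2)),
    (hasDerivAt_hillForm hfc α β γ x).deriv]
  simp only [hillForm, Nat.cast_ofNat, Nat.add_one_sub_one, pow_one]
  ring

theorem isHillSolution_combination {f : ℝ → ℝ} (hf : ContDiff ℝ ∞ f) (p q : ℂ) :
    IsHillSolution f fun x => p * (hillSol f 1 0 x : ℂ) + q * (hillSol f 0 1 x : ℂ) := by
  have hfc := hf.continuous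
  refine ⟨?_, fun x => ?_⟩
  · have h := fun a b => Complex.ofRealCLM.contDiff.comp (contDiff_hillSol_right hf a b)
    exact (contDiff_const.mul (h 1 0)).add (contDiff_const.mul (h 0 1))
  · rw [iteratedDeriv_two_of_hasDerivAt (k := fun x => p * (hillSol f 1 0 x : ℂ)
        + q * (hillSol f 0 1 x : ℂ))
      (fun x => ((hasDerivAt_hillSol hfc 1 0 x).ofReal_comp.const_mul p).add
        ((hasDerivAt_hillSol hfc 0 1 x).ofReal_comp.const_mul q))
      (fun x => ((hasDerivAt_hillVel hfc 1 0 x).ofReal_comp.const_mul p).add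
        ((hasDerivAt_hillVel hfc 0 1 x).ofReal_comp.const_mul q))]
    push_cast
    ring

/-- A binary quadratic form splits into linear factors over `ℂ`. -/
theorem isHillProduct_hillForm {f : ℝ → ℝ} (hf : ContDiff ℝ ∞ f) (α β γ : ℝ) :
    IsHillProduct f (hillForm f α β γ) := by
  suffices ∃ p q p' q' : ℂ, (α : ℂ) = p * p' ∧ (β : ℂ) = p * q' + q * p' ∧ (γ : ℂ) = q * q' by
    obtain ⟨p, q, p', q', h1, h2, h3⟩ := this
    refine ⟨_, _, isHillSolution_combination hf p q, isHillSolution_combination hf p' q',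
      fun x => ?_⟩
    simp only [hillForm]
    push_cast
    rw [h1, h2, h3]
    ring
  rcases eq_or_ne α 0 with rfl | hα
  · exact ⟨0, 1, β, γ, by simp⟩
  · obtain ⟨d, hd⟩ := IsAlgClosed.exists_pow_nat_eq ((β : ℂ) ^ 2 - 4 * α * γ) two_pos
    have hα' : (α : ℂ) ≠ 0 := by exact_mod_cast hα
    refine ⟨α, (β - d) / 2, 1, (β + d) / (2 * α), by simp, ?_, ?_⟩
    · field_simp
      ring
    · field_simp
      linear_combination hd

/-- The conserved pairing of a solution of the stabilizer equation with a product `y w` of two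
solutions of Hill's equation, `v` and `u` being the derivatives of `y` and `w`. -/
def stabilizerPairing (f k y v w u : ℝ → ℝ) (x : ℝ) : ℝ :=
  iteratedDeriv 2 k x * (y x * w x) - 2 * (f x * (k x * (y x * w x))) + 2 * (k x * (v x * u x))
    - deriv k x * (v x * w x + y x * u x)

theorem hasDerivAt_of_contDiff {k : ℝ → ℝ} (hk : ContDiff ℝ ∞ k) (x : ℝ) :
    HasDerivAt k (deriv k x) x ∧ HasDerivAt (deriv k) (iteratedDeriv 2 k x) x ∧
      HasDerivAt (iteratedDeriv 2 k) (iteratedDeriv 3 k x) x := by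
  have h : ∀ n : ℕ, DifferentiableAt ℝ (iteratedDeriv n k) x := fun n =>
    hk.differentiable_iteratedDeriv n (by exact_mod_cast ENat.natCast_lt_top n) x
  refine ⟨by simpa using (h 0).hasDerivAt, ?_, ?_⟩
  · simpa [iteratedDeriv_succ, iteratedDeriv_one] using (h 1).hasDerivAt
  · simpa [iteratedDeriv_succ] using (h 2).hasDerivAt

theorem stabilizerPairing_eq {f k y v w u : ℝ → ℝ} (hf : ContDiff ℝ ∞ f) (hk : IsStabilizer f k)
    (hy : IsForcedHillPair f 0 y v) (hw : IsForcedHillPair f 0 w u) (x : ℝ) :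
    stabilizerPairing f k y v w u x = stabilizerPairing f k y v w u 0 := by
  have h := eq_integral_of_hasDerivAt (w := 0) (W := stabilizerPairing f k y v w u) (fun x => by
    obtain ⟨k1, k2, k3⟩ := hasDerivAt_of_contDiff hk.smooth x
    have hf' := (hasDerivAt_of_contDiff hf x).1
    have hyw := (hy.pos x).mul (hw.pos x)
    refine ((((k3.mul hyw).sub ((hf'.mul (k1.mul hyw)).const_mul 2)).add
      ((k1.mul ((hy.vel x).mul (hw.vel x))).const_mul 2)).sub
      (k2.mul (((hy.vel x).mul (hw.pos x)).add ((hy.pos x).mul (hw.vel x))))).congr_deriv ?_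
    simp only [Pi.zero_apply, Pi.mul_apply, Pi.add_apply]
    linear_combination (y x * w x) * hk.eqn x) continuous_zero x
  simpa using h

/-- Every solution of the stabilizer equation is a quadratic form in the fundamental solutions. -/
theorem IsStabilizer.exists_eq_hillForm {f k : ℝ → ℝ} (hf : ContDiff ℝ ∞ f)
    (hk : IsStabilizer f k) : ∃ α β γ, k = hillForm f α β γ := by
  have h1 := isForcedHillPair_hillSol hf.continuous 1 0
  have h2 := isForcedHillPair_hillSol hf.continuous 0 1
  refine ⟨stabilizerPairing f k (hillSol f 0 1) (hillVel f 0 1) (hillSol f 0 1) (hillVel f 0 1) 0 / 2,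
    -stabilizerPairing f k (hillSol f 1 0) (hillVel f 1 0) (hillSol f 0 1) (hillVel f 0 1) 0,
    stabilizerPairing f k (hillSol f 1 0) (hillVel f 1 0) (hillSol f 1 0) (hillVel f 1 0) 0 / 2,
    funext fun x => ?_⟩
  rw [← stabilizerPairing_eq hf hk h2 h2 x, ← stabilizerPairing_eq hf hk h1 h2 x,
    ← stabilizerPairing_eq hf hk h1 h1 x]
  simp only [stabilizerPairing, hillForm]
  have hW := hill_wronskian hf.continuous x
  linear_combination (-k x * (hillSol f 1 0 x * hillVel f 0 1 x
    - hillVel f 1 0 x * hillSol f 0 1 x + 1)) * hW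

theorem hillForm_eq_zero {f : ℝ → ℝ} (hf : Continuous f) {α β γ : ℝ}
    (h : ∀ x, hillForm f α β γ x = 0) : α = 0 ∧ β = 0 ∧ γ = 0 := by
  have h1 := fun x => (hasDerivAt_hillForm hf α β γ x).deriv
  have h2 := fun x => (hasDerivAt_hillForm_deriv hf α β γ x).deriv
  rw [show hillForm f α β γ = fun _ => 0 from funext h] at h1
  simp only [← h1, deriv_const'] at h2
  have e0 := h 0
  have e1 := h1 0
  have e2 := h2 0
  simp only [hillForm, hillSol_zero hf, hillVel_zero, deriv_const] at e0 e1 e2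
  have hα : α = 0 := by linarith
  have hβ : β = 0 := by linarith
  refine ⟨hα, hβ, ?_⟩
  rw [hα, hβ] at e2
  linarith

/-- The trace of the monodromy matrix of Hill's equation. -/
def monodromyTrace (f : ℝ → ℝ) : ℝ := hillSol f 1 0 (2 * Real.pi) + hillVel f 0 1 (2 * Real.pi)

/-- The stabilizer that corresponds to the traceless part of the monodromy matrix. At `x` its value
is the upper right entry of the monodromy matrix with base point `x`
(`monodromyStabilizer_eq_kernel`). -/
def monodromyStabilizer (f : ℝ → ℝ) : ℝ → ℝ :=
  hillForm f (hillSol f 0 1 (2 * Real.pi))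
    (hillVel f 0 1 (2 * Real.pi) - hillSol f 1 0 (2 * Real.pi)) (-hillVel f 1 0 (2 * Real.pi))

/-- The translates of a solution by the period are expressed by the monodromy matrix. -/
theorem hillSol_add_two_pi {f : ℝ → ℝ} (hf : IsCircleField f) (a b x : ℝ) :
    hillSol f a b (x + 2 * Real.pi) = hillSol f a b (2 * Real.pi) * hillSol f 1 0 x
      + hillVel f a b (2 * Real.pi) * hillSol f 0 1 x ∧
    hillVel f a b (x + 2 * Real.pi) = hillSol f a b (2 * Real.pi) * hillVel f 1 0 x
      + hillVel f a b (2 * Real.pi) * hillVel f 0 1 x := by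
  have h : IsForcedHillPair f 0 (fun x => hillSol f a b (x + 2 * Real.pi))
      (fun x => hillVel f a b (x + 2 * Real.pi)) :=
    ⟨fun x => (hasDerivAt_hillSol hf.continuous a b _).comp_add_const _ _, fun x =>
      ((hasDerivAt_hillVel hf.continuous a b _).comp_add_const _ _).congr_deriv
        (by rw [hf.periodic]; simp)⟩
  simpa using h.eq_fundamental hf.continuous x

theorem monodromyStabilizer_eq_kernel {f : ℝ → ℝ} (hf : IsCircleField f) (x : ℝ) :
    monodromyStabilizer f x = hillSol f 1 0 x * hillSol f 0 1 (x + 2 * Real.pi)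
      - hillSol f 0 1 x * hillSol f 1 0 (x + 2 * Real.pi) := by
  rw [(hillSol_add_two_pi hf 0 1 x).1, (hillSol_add_two_pi hf 1 0 x).1]
  simp only [monodromyStabilizer, hillForm]
  ring

theorem isCircleField_monodromyStabilizer {f : ℝ → ℝ} (hf : IsCircleField f) :
    IsCircleField (monodromyStabilizer f) := by
  refine ⟨(isStabilizer_hillForm hf.smooth _ _ _).smooth, fun x => ?_⟩
  have hW := hill_wronskian hf.continuous (2 * Real.pi)
  simp only [monodromyStabilizer, hillForm, (hillSol_add_two_pi hf _ _ x).1]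
  linear_combination (hillSol f 0 1 (2 * Real.pi) * hillSol f 1 0 x ^ 2
    + (hillVel f 0 1 (2 * Real.pi) - hillSol f 1 0 (2 * Real.pi))
      * (hillSol f 1 0 x * hillSol f 0 1 x)
    - hillVel f 1 0 (2 * Real.pi) * hillSol f 0 1 x ^ 2) * hW

/-- If the traceless part of the monodromy matrix vanishes, then the matrix is `1` or `-1`, and
all products of two solutions are periodic. -/
theorem isExceptional_of_monodromyStabilizer_eq_zero {f : ℝ → ℝ} (hf : IsCircleField f)
    (h : ∀ x, monodromyStabilizer f x = 0) : IsExceptional f := by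
  obtain ⟨hB, hDA, hC⟩ := hillForm_eq_zero hf.continuous h
  have hW := hill_wronskian hf.continuous (2 * Real.pi)
  intro k hk
  obtain ⟨α, β, γ, rfl⟩ := hk.exists_eq_hillForm hf.smooth
  intro x
  simp only [hillForm, (hillSol_add_two_pi hf _ _ x).1]
  have hC' : hillVel f 1 0 (2 * Real.pi) = 0 := by linarith
  have hD : hillVel f 0 1 (2 * Real.pi) = hillSol f 1 0 (2 * Real.pi) := by linarith
  rw [hD, hC', hB] at hW
  rw [hD, hC', hB]
  linear_combination (α * hillSol f 1 0 x ^ 2 + β * (hillSol f 1 0 x * hillSol f 0 1 x)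
    + γ * hillSol f 0 1 x ^ 2) * hW

/-- A periodic solution of the stabilizer equation is a quadratic form invariant under the
monodromy matrix, hence proportional to its traceless part if the latter does not vanish. -/
theorem exists_eq_smul_monodromyStabilizer {f k : ℝ → ℝ} (hf : IsCircleField f)
    (h : monodromyStabilizer f ≠ 0) (hk : IsCircleField k) (hs : IsStabilizer f k) :
    ∃ a : ℝ, k = a • monodromyStabilizer f := by
  obtain ⟨α, β, γ, rfl⟩ := hs.exists_eq_hillForm hf.smooth
  have hW := hill_wronskian hf.continuous (2 * Real.pi)
  set A := hillSol f 1 0 (2 * Real.pi) with hA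
  set B := hillSol f 0 1 (2 * Real.pi) with hB
  set C := hillVel f 1 0 (2 * Real.pi) with hC
  set D := hillVel f 0 1 (2 * Real.pi) with hD
  have hinv : ∀ x, hillForm f (α * A ^ 2 + β * (A * B) + γ * B ^ 2 - α)
      (2 * α * (A * C) + β * (A * D + B * C) + 2 * γ * (B * D) - β)
      (α * C ^ 2 + β * (C * D) + γ * D ^ 2 - γ) x = 0 := by
    intro x
    have := hk.periodic x
    simp only [hillForm, (hillSol_add_two_pi hf _ _ x).1] at this ⊢
    linear_combination this
  obtain ⟨e1, e2, e3⟩ := hillForm_eq_zero hf.continuous hinv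
  -- Multiplying `Mᵀ S M = S` by the inverse of `M` makes the invariance linear in `M`.
  have f1 : α * (D - A) = β * B := by
    linear_combination (-D) * e1 + (B / 2) * e2 + (α * A + β * B / 2) * hW
  have f2 : α * C + γ * B = 0 := by
    linear_combination (D / 2) * e2 - B * e3 - (α * C + β * D / 2) * hW
  have f3 : β * C + γ * (D - A) = 0 := by
    linear_combination (-C / 2) * e2 + A * e3 - (β * C / 2 + γ * D) * hW
  have hsmul : ∀ a, α = a * B → β = a * (D - A) → γ = a * (-C) →
      hillForm f α β γ = a • monodromyStabilizer f := by
    rintro a h1 h2 h3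
    ext x
    simp only [Pi.smul_apply, smul_eq_mul, monodromyStabilizer, hillForm, ← hA, ← hB, ← hC, ← hD,
      h1, h2, h3]
    ring
  by_cases hB0 : B = 0
  · by_cases hDA : D - A = 0
    · have hC0 : C ≠ 0 := by
        rintro hC0
        refine h (funext fun x => ?_)
        simp [monodromyStabilizer, hillForm, ← hA, ← hB, ← hC, ← hD, hB0, hDA, hC0]
      simp only [hB0, hDA, mul_zero, add_zero, mul_eq_zero, hC0, or_false] at f2 f3
      exact ⟨-γ / C, hsmul _ (by simp [f2, hB0]) (by simp [f3, hDA]) (by field_simp)⟩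
    · simp only [hB0, mul_zero, mul_eq_zero, hDA, or_false] at f1
      exact ⟨β / (D - A), hsmul _ (by simp [f1, hB0]) (by field_simp)
        (by field_simp; linear_combination f3)⟩
  · exact ⟨α / B, hsmul _ (by field_simp) (by field_simp; linear_combination -f1)
      (by field_simp; linear_combination f2)⟩

/-! ### Variation of the monodromy -/

theorem contDiff_monodromyTrace {E : Type} [NormedAddCommGroup E] [NormedSpace ℝ E]
    [FiniteDimensional ℝ E] {F : E → ℝ → ℝ} (hF : ContDiff ℝ ∞ (Function.uncurry F)) :
    ContDiff ℝ ∞ fun s => monodromyTrace (F s) := by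
  have h : ContDiff ℝ ∞ fun s : E => (s, 2 * Real.pi) := contDiff_id.prodMk contDiff_const
  exact ((contDiff_hillSol hF 1 0).comp h).add ((contDiff_hillVel hF 0 1).comp h)

theorem contDiff_monodromyStabilizer {E : Type} [NormedAddCommGroup E] [NormedSpace ℝ E]
    [FiniteDimensional ℝ E] {F : E → ℝ → ℝ} (hF : ContDiff ℝ ∞ (Function.uncurry F)) :
    ContDiff ℝ ∞ (Function.uncurry fun s => monodromyStabilizer (F s)) := by
  have h : ContDiff ℝ ∞ fun p : E × ℝ => (p.1, 2 * Real.pi) := contDiff_fst.prodMk contDiff_const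
  have h1 := contDiff_hillSol hF 1 0
  have h2 := contDiff_hillSol hF 0 1
  exact (((h2.comp h).mul (h1.pow 2)).add
    ((((contDiff_hillVel hF 0 1).comp h).sub (h1.comp h)).mul (h1.mul h2))).add
    (((contDiff_hillVel hF 1 0).comp h).neg.mul (h2.pow 2))

theorem hasDerivAt_left {F : ℝ → ℝ → ℝ} (hF : ContDiff ℝ ∞ (Function.uncurry F)) (s x : ℝ) :
    HasDerivAt (fun u => F u x) (deriv (fun u => F u x) s) s :=
  ((hF.comp (contDiff_id.prodMk contDiff_const)).differentiable (by simp) s).hasDerivAt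

theorem contDiff_deriv_left {F : ℝ → ℝ → ℝ} (hF : ContDiff ℝ ∞ (Function.uncurry F)) :
    ContDiff ℝ ∞ (Function.uncurry fun s x => deriv (fun u => F u x) s) :=
  contDiff_infty.2 fun n => (contDiff_fderiv_left (n := n) (hF.of_le (by
    exact_mod_cast le_top))).clm_apply contDiff_const

theorem hasDerivAt_hillSol_param {F : ℝ → ℝ → ℝ} (hF : ContDiff ℝ ∞ (Function.uncurry F))
    (a b s x : ℝ) :
    HasDerivAt (fun u => hillSol (F u) a b x)
      (hillSol (F s) 0 1 x * (∫ z in (0 : ℝ)..x,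
          hillSol (F s) 1 0 z * (deriv (fun u => F u z) s * hillSol (F s) a b z))
        - hillSol (F s) 1 0 x * ∫ z in (0 : ℝ)..x,
          hillSol (F s) 0 1 z * (deriv (fun u => F u z) s * hillSol (F s) a b z)) s ∧
    HasDerivAt (fun u => hillVel (F u) a b x)
      (hillVel (F s) 0 1 x * (∫ z in (0 : ℝ)..x,
          hillSol (F s) 1 0 z * (deriv (fun u => F u z) s * hillSol (F s) a b z))
        - hillVel (F s) 1 0 x * ∫ z in (0 : ℝ)..x,
          hillSol (F s) 0 1 z * (deriv (fun u => F u z) s * hillSol (F s) a b z)) s := by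
  have hF1 : ContDiff ℝ 1 (Function.uncurry F) := hF.of_le (by simp)
  have hvar : ∀ c d, hillVariation F c d a b s x 1 = ∫ z in (0 : ℝ)..x,
      hillSol (F s) c d z * (deriv (fun u => F u z) s * hillSol (F s) a b z) := by
    intro c d
    rw [hillVariation, ContinuousLinearMap.intervalIntegral_apply]
    · refine intervalIntegral.integral_congr fun z _ => ?_
      simp only [smul_apply, fderiv_eq_smul_deriv, smul_eq_mul, one_mul]
      ring
    · have hFs : Continuous (F s) := hF.continuous.comp (continuous_const.prodMk continuous_id)
      have h := (contDiff_fderiv_left (n := 0) (G := F) (by simpa using hF1)).continuous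
      exact (((continuous_hillSol_right hFs c d).mul (continuous_hillSol_right hFs a b)).smul
        (h.comp (continuous_const.prodMk continuous_id))).intervalIntegrable _ _
  obtain ⟨h1, h2⟩ := hasFDerivAt_hillSol_param hF1 a b s x
  rw [← hvar 1 0, ← hvar 0 1]
  exact ⟨h1.hasDerivAt, h2.hasDerivAt⟩

/-- The gradient of the trace of the monodromy matrix is the associated stabilizer. -/
theorem hasDerivAt_monodromyTrace {F : ℝ → ℝ → ℝ} (hF : ContDiff ℝ ∞ (Function.uncurry F))
    (s : ℝ) :
    HasDerivAt (fun u => monodromyTrace (F u))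
      (∫ z in (0 : ℝ)..(2 * Real.pi), monodromyStabilizer (F s) z * deriv (fun u => F u z) s) s := by
  have hFs : Continuous (F s) := hF.continuous.comp (continuous_const.prodMk continuous_id)
  have hd : Continuous fun z => deriv (fun u => F u z) s :=
    (contDiff_deriv_left hF).continuous.comp (continuous_const.prodMk continuous_id)
  have h1 := continuous_hillSol_right hFs 1 0
  have h2 := continuous_hillSol_right hFs 0 1
  refine ((hasDerivAt_hillSol_param hF 1 0 s (2 * Real.pi)).1.add
    (hasDerivAt_hillSol_param hF 0 1 s (2 * Real.pi)).2).congr_deriv ?_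
  simp only [← intervalIntegral.integral_const_mul]
  rw [← intervalIntegral.integral_sub, ← intervalIntegral.integral_sub,
    ← intervalIntegral.integral_add]
  · refine intervalIntegral.integral_congr fun z _ => ?_
    simp only [monodromyStabilizer, hillForm]
    ring
  all_goals exact Continuous.intervalIntegrable (by fun_prop) _ _

/-! ### Normalization on constant potentials -/

theorem monodromyStabilizer_const (c x : ℝ) :
    monodromyStabilizer (fun _ => c) x = hillSol (fun _ => c) 0 1 (2 * Real.pi) := by
  have hc : Continuous fun _ : ℝ => c := continuous_const
  have h : IsForcedHillPair (fun _ => c) 0 (hillVel (fun _ => c) 0 1)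
      (fun x => c * hillSol (fun _ => c) 0 1 x) :=
    ⟨fun x => hasDerivAt_hillVel hc 0 1 x, fun x => by
      simpa using (hasDerivAt_hillSol hc 0 1 x).const_mul c⟩
  have h1 := fun x => h.eq_fundamental hc x
  simp only [hillSol_zero hc, hillVel_zero, mul_zero, zero_mul, add_zero, one_mul] at h1
  have hW := hill_wronskian hc x
  rw [(h1 x).1, ← (h1 x).2] at hW
  simp only [monodromyStabilizer, hillForm, ← (h1 _).2, (h1 (2 * Real.pi)).1]
  linear_combination hillSol (fun _ => c) 0 1 (2 * Real.pi) * hW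

theorem contDiff_monodromyTrace_const : ContDiff ℝ ∞ fun c : ℝ => monodromyTrace fun _ => c :=
  contDiff_monodromyTrace (F := fun (c : ℝ) _ => c) contDiff_fst

theorem deriv_monodromyTrace_const (c : ℝ) :
    deriv (fun c : ℝ => monodromyTrace fun _ => c) c
      = 2 * Real.pi * hillSol (fun _ => c) 0 1 (2 * Real.pi) := by
  have := (hasDerivAt_monodromyTrace (F := fun (c : ℝ) _ => c) contDiff_fst c).deriv
  simpa [monodromyStabilizer_const] using this

theorem one_lt_deriv_monodromyTrace_const {c : ℝ} (hc : 0 ≤ c) :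
    1 < deriv (fun c : ℝ => monodromyTrace fun _ => c) c := by
  rw [deriv_monodromyTrace_const]
  have h := le_hillSol_of_nonneg (f := fun _ => c) continuous_const (fun _ => hc)
    Real.two_pi_pos.le
  nlinarith [Real.pi_gt_three]

/-- A smooth function which is increasing on the right half-line has there a left inverse
that is a global diffeomorphism: its derivative is cut off to `1` on the left half-line. -/
theorem exists_smooth_leftInverse {g : ℝ → ℝ} (hg : ContDiff ℝ ∞ g)
    (h1 : ∀ c, 0 ≤ c → 1 < deriv g c) :
    ∃ N : ℝ → ℝ, ContDiff ℝ ∞ N ∧ (∀ x, deriv N x ≠ 0) ∧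
      ∀ c, 0 ≤ c → N (g c) = c ∧ deriv N (g c) * deriv g c = 1 := by
  have hg' : ContDiff ℝ ∞ (deriv g) := (contDiff_infty_iff_deriv.1 hg).2
  obtain ⟨δ, hδ, hδ'⟩ : ∃ δ > 0, ∀ c, -δ < c → 1 < deriv g c := by
    obtain ⟨δ, hδ, h⟩ := Metric.eventually_nhds_iff.1
      (hg'.continuous.continuousAt.eventually (lt_mem_nhds (h1 0 le_rfl)))
    refine ⟨δ, hδ, fun c hc => ?_⟩
    rcases le_or_gt 0 c with hc0 | hc0
    · exact h1 c hc0
    · refine h ?_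
      rw [Real.dist_eq, sub_zero, abs_of_neg hc0]
      linarith
  set ρ : ℝ → ℝ := fun c => Real.smoothTransition ((c + δ) / δ) with hρ
  have hρs : ContDiff ℝ ∞ ρ :=
    Real.smoothTransition.contDiff.comp ((contDiff_id.add contDiff_const).div_const δ)
  set w : ℝ → ℝ := fun c => ρ c * deriv g c + (1 - ρ c) with hw
  have hws : ContDiff ℝ ∞ w := (hρs.mul hg').add (contDiff_const.sub hρs)
  have hw1 : ∀ c, 1 ≤ w c := by
    intro c
    rcases le_or_gt c (-δ) with hc | hc
    · have : ρ c = 0 := Real.smoothTransition.zero_of_nonpos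
        (div_nonpos_of_nonpos_of_nonneg (by linarith) hδ.le)
      simp [hw, this]
    · have h0 : 0 ≤ ρ c := Real.smoothTransition.nonneg _
      have := hδ' c hc
      simp only [hw]
      nlinarith
  have hwg : ∀ c, 0 ≤ c → w c = deriv g c := by
    intro c hc
    have : ρ c = 1 := Real.smoothTransition.one_of_one_le ((one_le_div hδ).2 (by linarith))
    simp [hw, this]
  set e : ℝ → ℝ := fun c => g 0 + ∫ z in (0 : ℝ)..c, w z with he
  have hed : ∀ c, HasDerivAt e (w c) c := fun c =>
    (hws.continuous.integral_hasStrictDerivAt 0 c).hasDerivAt.const_add _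
  have hes : ContDiff ℝ ∞ e := contDiff_infty_iff_deriv.2
    ⟨fun c => (hed c).differentiableAt, by rwa [funext fun c => (hed c).deriv]⟩
  have heg : ∀ c, 0 ≤ c → e c = g c := by
    intro c hc
    have h2 := eq_integral_of_hasDerivAt
      (fun x => (hg.differentiable (by simp) x).hasDerivAt) hg'.continuous c
    rw [h2]
    simp only [he]
    congr 1
    refine intervalIntegral.integral_congr fun z hz => ?_
    rw [uIcc_of_le hc] at hz
    exact hwg z hz.1
  have hmono : StrictMono e := strictMono_of_deriv_pos fun c => by
    rw [(hed c).deriv]; linarith [hw1 c]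
  have hmono' : Monotone fun c => e c - c := by
    refine monotone_of_deriv_nonneg (fun c => ((hed c).sub (hasDerivAt_id c)).differentiableAt)
      fun c => ?_
    have := ((hed c).sub (hasDerivAt_id c)).deriv
    rw [show (fun c => e c - c) = e - id from rfl, this]
    linarith [hw1 c]
  have hsurj : Function.Surjective e := by
    refine hes.continuous.surjective (tendsto_atTop_mono' _ ?_
      (tendsto_atTop_add_const_left _ (e 0) tendsto_id)) (tendsto_atBot_mono' _ ?_
      (tendsto_atBot_add_const_left _ (e 0) tendsto_id))
    · filter_upwards [eventually_ge_atTop 0] with c hc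
      have := hmono' hc
      simp only [sub_zero, id] at this ⊢
      linarith
    · filter_upwards [eventually_le_atBot 0] with c hc
      have := hmono' hc
      simp only [sub_zero, id] at this ⊢
      linarith
  set H : ℝ ≃ₜ ℝ := (hmono.orderIsoOfSurjective e hsurj).toHomeomorph with hH
  have hHe : ∀ c, H c = e c := fun c => rfl
  have hNs : ContDiff ℝ ∞ H.symm :=
    H.contDiff_symm_deriv (f' := w) (fun c => by linarith [hw1 c]) hed hes
  have hmul : ∀ c, deriv H.symm (e c) * w c = 1 := by
    intro c
    have h2 : HasDerivAt (H.symm ∘ e) (deriv H.symm (e c) * w c) c :=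
      (hNs.differentiable (by simp) (e c)).hasDerivAt.comp c (hed c)
    have h3 : H.symm ∘ e = id := funext fun c => H.symm_apply_apply c
    rw [h3] at h2
    exact h2.unique (hasDerivAt_id c)
  refine ⟨H.symm, hNs, fun x hx => ?_, fun c hc => ⟨?_, ?_⟩⟩
  · obtain ⟨c, rfl⟩ := hsurj x
    have := hmul c
    rw [hx] at this
    simp at this
  · rw [← heg c hc]
    exact H.symm_apply_apply c
  · rw [← heg c hc, ← hwg c hc]
    exact hmul c

/-- A smooth reparametrization of the trace of the monodromy matrix which returns the potential
`c` at constant potentials `c ≥ 0`. -/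
def orbitLabel : ℝ → ℝ :=
  (exists_smooth_leftInverse contDiff_monodromyTrace_const
    fun _ => one_lt_deriv_monodromyTrace_const).choose

theorem orbitLabel_spec : ContDiff ℝ ∞ orbitLabel ∧ (∀ x, deriv orbitLabel x ≠ 0) ∧
    ∀ c, 0 ≤ c → orbitLabel (monodromyTrace fun _ => c) = c ∧
      deriv orbitLabel (monodromyTrace fun _ => c)
        * deriv (fun c : ℝ => monodromyTrace fun _ => c) c = 1 :=
  (exists_smooth_leftInverse contDiff_monodromyTrace_const
    fun _ => one_lt_deriv_monodromyTrace_const).choose_spec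

/-- The field dependent stabilizer `K(f)`: up to a constant, the gradient of
`orbitLabel (monodromyTrace f)`. -/
def orbitStabilizer (f : ℝ → ℝ) : ℝ → ℝ :=
  (2 * Real.pi * deriv orbitLabel (monodromyTrace f)) • monodromyStabilizer f

theorem orbitStabilizer_factor_ne_zero (f : ℝ → ℝ) :
    2 * Real.pi * deriv orbitLabel (monodromyTrace f) ≠ 0 :=
  mul_ne_zero Real.two_pi_pos.ne' (orbitLabel_spec.2.1 _)

theorem smul_hillForm (f : ℝ → ℝ) (a α β γ : ℝ) :
    a • hillForm f α β γ = hillForm f (a * α) (a * β) (a * γ) := by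
  ext x
  simp only [hillForm, Pi.smul_apply, smul_eq_mul]
  ring

theorem isCircleField_orbitStabilizer {f : ℝ → ℝ} (hf : IsCircleField f) :
    IsCircleField (orbitStabilizer f) :=
  ⟨contDiff_const.smul (isCircleField_monodromyStabilizer hf).smooth, fun x => by
    simp [orbitStabilizer, (isCircleField_monodromyStabilizer hf).periodic x]⟩

theorem isStabilizer_orbitStabilizer {f : ℝ → ℝ} (hf : IsCircleField f) :
    IsStabilizer f (orbitStabilizer f) := by
  rw [orbitStabilizer, monodromyStabilizer, smul_hillForm]
  exact isStabilizer_hillForm hf.smooth _ _ _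

theorem isHillProduct_orbitStabilizer {f : ℝ → ℝ} (hf : IsCircleField f) :
    IsHillProduct f (orbitStabilizer f) := by
  rw [orbitStabilizer, monodromyStabilizer, smul_hillForm]
  exact isHillProduct_hillForm hf.smooth _ _ _

theorem isExceptional_or_orbitStabilizer {f : ℝ → ℝ} (hf : IsCircleField f) :
    IsExceptional f ∨ orbitStabilizer f ≠ 0 ∧
      ∀ k, IsCircleField k → IsStabilizer f k → ∃ a : ℝ, k = a • orbitStabilizer f := by
  by_cases h : monodromyStabilizer f = 0
  · exact .inl (isExceptional_of_monodromyStabilizer_eq_zero hf fun x => congrFun h x)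
  · refine .inr ⟨smul_ne_zero (orbitStabilizer_factor_ne_zero f) h, fun k hk hs => ?_⟩
    obtain ⟨a, rfl⟩ := exists_eq_smul_monodromyStabilizer hf h hk hs
    refine ⟨a / (2 * Real.pi * deriv orbitLabel (monodromyTrace f)), ?_⟩
    rw [orbitStabilizer, smul_smul, div_mul_cancel₀ _ (orbitStabilizer_factor_ne_zero f)]

theorem contDiff_orbitStabilizer {E : Type} [NormedAddCommGroup E] [NormedSpace ℝ E]
    [FiniteDimensional ℝ E] {F : E → ℝ → ℝ} (hF : ContDiff ℝ ∞ (Function.uncurry F)) :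
    ContDiff ℝ ∞ (Function.uncurry fun s => orbitStabilizer (F s)) := by
  have h : ContDiff ℝ ∞ (deriv orbitLabel) := (contDiff_infty_iff_deriv.1 orbitLabel_spec.1).2
  exact (contDiff_const.mul (h.comp ((contDiff_monodromyTrace hF).comp contDiff_fst))).smul
    (contDiff_monodromyStabilizer hF)

theorem orbitStabilizer_const {c : ℝ} (hc : 0 ≤ c) : orbitStabilizer (fun _ => c) = fun _ => 1 := by
  ext x
  have h := (orbitLabel_spec.2.2 c hc).2
  rw [deriv_monodromyTrace_const] at h
  simp only [orbitStabilizer, Pi.smul_apply, smul_eq_mul, monodromyStabilizer_const]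
  linear_combination h

theorem hasDerivAt_orbitLabel {F : ℝ → ℝ → ℝ} (hF : ContDiff ℝ ∞ (Function.uncurry F))
    (s : ℝ) :
    HasDerivAt (fun u => orbitLabel (monodromyTrace (F u))) ((2 * Real.pi)⁻¹ *
      ∫ z in (0 : ℝ)..(2 * Real.pi), orbitStabilizer (F s) z * deriv (fun u => F u z) s) s := by
  refine ((orbitLabel_spec.1.differentiable (by simp) _).hasDerivAt.comp s
    (hasDerivAt_monodromyTrace hF s)).congr_deriv ?_
  simp only [orbitStabilizer, Pi.smul_apply, smul_eq_mul, mul_assoc,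
    intervalIntegral.integral_const_mul]
  have := Real.pi_ne_zero
  field_simp

/-! ### Coadjoint covariance -/

theorem periodic_deriv {V : Type} [NormedAddCommGroup V] [NormedSpace ℝ V] {f : ℝ → V} {c : ℝ}
    (hf : Function.Periodic f c) : Function.Periodic (deriv f) c := fun x => by
  rw [← deriv_comp_add_const, funext hf]

theorem IsCircleField.deriv {f : ℝ → ℝ} (hf : IsCircleField f) : IsCircleField (deriv f) :=
  ⟨(contDiff_infty_iff_deriv.1 hf.smooth).2, periodic_deriv hf.periodic⟩

theorem IsCircleField.iteratedDeriv {f : ℝ → ℝ} (hf : IsCircleField f) (n : ℕ) :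
    IsCircleField (iteratedDeriv n f) := by
  induction n with
  | zero => simpa using hf
  | succ n ih => rw [iteratedDeriv_succ]; exact ih.deriv

theorem IsCircleField.add {f g : ℝ → ℝ} (hf : IsCircleField f) (hg : IsCircleField g) :
    IsCircleField (f + g) :=
  ⟨hf.smooth.add hg.smooth, hf.periodic.add hg.periodic⟩

theorem IsCircleField.mul {f g : ℝ → ℝ} (hf : IsCircleField f) (hg : IsCircleField g) :
    IsCircleField (f * g) :=
  ⟨hf.smooth.mul hg.smooth, hf.periodic.mul hg.periodic⟩

theorem IsCircleField.smul {f : ℝ → ℝ} (hf : IsCircleField f) (a : ℝ) : IsCircleField (a • f) :=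
  ⟨contDiff_const.smul hf.smooth, hf.periodic.smul a⟩

/-- The infinitesimal coadjoint action `ε f' + 2 f ε' - ε''' / 2` of the vector field `ε`. -/
def coadjointVariation (ε f : ℝ → ℝ) (x : ℝ) : ℝ :=
  ε x * deriv f x + 2 * f x * deriv ε x - iteratedDeriv 3 ε x / 2

theorem deltaL_apply (ε L : Fields) (σ : Sector) :
    deltaL ε L σ = coadjointVariation (ε σ) (L σ) := rfl

theorem isCircleField_coadjointVariation {ε f : ℝ → ℝ} (hε : IsCircleField ε)
    (hf : IsCircleField f) : IsCircleField (coadjointVariation ε f) := by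
  have h := ((hε.mul hf.deriv).add ((hf.mul hε.deriv).smul 2)).add
    ((hε.iteratedDeriv 3).smul (-1 / 2))
  convert h using 1
  ext x
  simp only [coadjointVariation, Pi.add_apply, Pi.mul_apply, Pi.smul_apply, smul_eq_mul]
  ring

theorem isStabilizer_iff_coadjointVariation {k f : ℝ → ℝ} (hk : ContDiff ℝ ∞ k) :
    IsStabilizer f k ↔ coadjointVariation k f = 0 := by
  refine ⟨fun h => funext fun x => ?_, fun h => ⟨hk, fun x => ?_⟩⟩
  · have := h.eqn x
    simp only [coadjointVariation, Pi.zero_apply]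
    linarith
  · have := congrFun h x
    simp only [coadjointVariation, Pi.zero_apply] at this
    linarith

theorem contDiff_add_smul {f v : ℝ → ℝ} (hf : ContDiff ℝ ∞ f) (hv : ContDiff ℝ ∞ v) :
    ContDiff ℝ ∞ (Function.uncurry fun s : ℝ => f + s • v) :=
  (hf.comp contDiff_snd).add (contDiff_fst.mul (hv.comp contDiff_snd))

theorem deriv_add_smul (f v : ℝ → ℝ) (s x : ℝ) :
    deriv (fun s : ℝ => (f + s • v) x) s = v x := by
  simp

/-- Solutions of Hill's equation are densities of weight `-1/2`: along the coadjoint action of `ε`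
a solution `y` varies by `ε y' - ε' y / 2`, up to the solution which restores the initial values. -/
theorem hasDerivAt_hillSol_coadjoint {f ε : ℝ → ℝ} (hf : ContDiff ℝ ∞ f) (hε : ContDiff ℝ ∞ ε)
    (hv : ContDiff ℝ ∞ (coadjointVariation ε f)) (a b x : ℝ) :
    HasDerivAt (fun s : ℝ => hillSol (f + s • coadjointVariation ε f) a b x)
      (ε x * hillVel f a b x - deriv ε x / 2 * hillSol f a b x
        - ((ε 0 * b - deriv ε 0 / 2 * a) * hillSol f 1 0 x
          + (deriv ε 0 / 2 * b + (ε 0 * f 0 - iteratedDeriv 2 ε 0 / 2) * a)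
            * hillSol f 0 1 x)) 0 := by
  have hfc := hf.continuous
  have hpair : IsForcedHillPair f (fun z => coadjointVariation ε f z * hillSol f a b z)
      (fun x => ε x * hillVel f a b x - deriv ε x / 2 * hillSol f a b x)
      (fun x => deriv ε x / 2 * hillVel f a b x
        + (ε x * f x - iteratedDeriv 2 ε x / 2) * hillSol f a b x) := by
    constructor
    · intro x
      obtain ⟨e1, e2, e3⟩ := hasDerivAt_of_contDiff hε x
      refine ((e1.mul (hasDerivAt_hillVel hfc a b x)).sub
        ((e2.div_const 2).mul (hasDerivAt_hillSol hfc a b x))).congr_deriv ?_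
      ring
    · intro x
      obtain ⟨e1, e2, e3⟩ := hasDerivAt_of_contDiff hε x
      obtain ⟨f1, -, -⟩ := hasDerivAt_of_contDiff hf x
      refine (((e2.div_const 2).mul (hasDerivAt_hillVel hfc a b x)).add
        (((e1.mul f1).sub (e3.div_const 2)).mul (hasDerivAt_hillSol hfc a b x))).congr_deriv ?_
      simp only [coadjointVariation, Pi.sub_apply, Pi.mul_apply]
      ring
  have hu := (hpair.eq_variation hfc (hv.continuous.mul (continuous_hillSol_right hfc a b)) x).1
  have hd := (hasDerivAt_hillSol_param (contDiff_add_smul hf hv) a b 0 x).1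
  simp only [deriv_add_smul, zero_smul, add_zero] at hd
  refine hd.congr_deriv ?_
  rw [hu]
  simp only [hillSol_zero hfc, hillVel_zero, Pi.mul_apply]
  ring

/-- The monodromy stabilizer is a vector field: along the coadjoint action of `ε` it varies by the
Lie bracket with `ε`. -/
theorem hasDerivAt_monodromyStabilizer_coadjoint {f ε : ℝ → ℝ} (hf : IsCircleField f)
    (hε : IsCircleField ε) (x : ℝ) :
    HasDerivAt (fun s : ℝ => monodromyStabilizer (f + s • coadjointVariation ε f) x)
      (ε x * deriv (monodromyStabilizer f) x - deriv ε x * monodromyStabilizer f x) 0 := by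
  have hv := isCircleField_coadjointVariation hε hf
  have h := fun a b x => hasDerivAt_hillSol_coadjoint hf.smooth hε.smooth hv.smooth a b x
  have hfc := hf.continuous
  have hk : HasDerivAt (monodromyStabilizer f)
      ((hillVel f 1 0 x * hillSol f 0 1 (x + 2 * Real.pi)
          + hillSol f 1 0 x * hillVel f 0 1 (x + 2 * Real.pi))
        - (hillVel f 0 1 x * hillSol f 1 0 (x + 2 * Real.pi)
          + hillSol f 0 1 x * hillVel f 1 0 (x + 2 * Real.pi))) x := by
    rw [funext (monodromyStabilizer_eq_kernel hf)]
    exact ((hasDerivAt_hillSol hfc 1 0 x).mul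
      ((hasDerivAt_hillSol hfc 0 1 _).comp_add_const x (2 * Real.pi))).sub
      ((hasDerivAt_hillSol hfc 0 1 x).mul
        ((hasDerivAt_hillSol hfc 1 0 _).comp_add_const x (2 * Real.pi)))
  have hfam : (fun s : ℝ => monodromyStabilizer (f + s • coadjointVariation ε f) x) = fun s : ℝ =>
      hillSol (f + s • coadjointVariation ε f) 1 0 x
        * hillSol (f + s • coadjointVariation ε f) 0 1 (x + 2 * Real.pi)
      - hillSol (f + s • coadjointVariation ε f) 0 1 x
        * hillSol (f + s • coadjointVariation ε f) 1 0 (x + 2 * Real.pi) :=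
    funext fun s => monodromyStabilizer_eq_kernel (hf.add (hv.smul s)) x
  rw [hfam, hk.deriv, monodromyStabilizer_eq_kernel hf]
  refine (((h 1 0 x).mul (h 0 1 (x + 2 * Real.pi))).sub
    ((h 0 1 x).mul (h 1 0 (x + 2 * Real.pi)))).congr_deriv ?_
  simp only [zero_smul, add_zero, hε.periodic x, hε.deriv.periodic x]
  ring

/-- Integration by parts: the pairing of a periodic stabilizer with an infinitesimal coadjoint
variation is the integral of a total derivative. -/
theorem integral_stabilizer_mul_coadjointVariation {f k ε : ℝ → ℝ} (hf : IsCircleField f)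
    (hε : IsCircleField ε) (hk : IsCircleField k) (hs : IsStabilizer f k) :
    ∫ x in (0 : ℝ)..(2 * Real.pi), k x * coadjointVariation ε f x = 0 := by
  have hd : ∀ x, HasDerivAt (fun x => -(1 / 2) * (k x * iteratedDeriv 2 ε x - deriv k x * deriv ε x
      + iteratedDeriv 2 k x * ε x) + 2 * (f x * (k x * ε x)))
      (k x * coadjointVariation ε f x) x := by
    intro x
    obtain ⟨e1, e2, e3⟩ := hasDerivAt_of_contDiff hε.smooth x
    obtain ⟨k1, k2, k3⟩ := hasDerivAt_of_contDiff hk.smooth x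
    obtain ⟨f1, -, -⟩ := hasDerivAt_of_contDiff hf.smooth x
    refine (((((k1.mul e3).sub (k2.mul e2)).add (k3.mul e1)).const_mul (-(1 / 2))).add
      ((f1.mul (k1.mul e1)).const_mul 2)).congr_deriv ?_
    simp only [coadjointVariation, Pi.mul_apply]
    linear_combination (-(1 / 2) * ε x) * hs.eqn x
  rw [intervalIntegral.integral_eq_sub_of_hasDerivAt (fun x _ => hd x)
    ((hk.mul (isCircleField_coadjointVariation hε hf)).continuous.intervalIntegrable _ _),
    hk.periodic.eq, hk.deriv.periodic.eq, (hk.iteratedDeriv 2).periodic.eq, hε.periodic.eq,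
    hε.deriv.periodic.eq, (hε.iteratedDeriv 2).periodic.eq, hf.periodic.eq, sub_self]

theorem hasDerivAt_monodromyTrace_coadjoint {f ε : ℝ → ℝ} (hf : IsCircleField f)
    (hε : IsCircleField ε) :
    HasDerivAt (fun s : ℝ => monodromyTrace (f + s • coadjointVariation ε f)) 0 0 := by
  have hv := isCircleField_coadjointVariation hε hf
  refine (hasDerivAt_monodromyTrace (contDiff_add_smul hf.smooth hv.smooth) 0).congr_deriv ?_
  simp only [deriv_add_smul, zero_smul, add_zero]
  exact integral_stabilizer_mul_coadjointVariation hf hε (isCircleField_monodromyStabilizer hf)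
    (isStabilizer_hillForm hf.smooth _ _ _)

/-- The field dependent stabilizer is equivariant, as it is a multiple of the monodromy stabilizer by
a function of the trace, which is stationary along the coadjoint action. -/
theorem hasDerivAt_orbitStabilizer_coadjoint {f ε : ℝ → ℝ} (hf : IsCircleField f)
    (hε : IsCircleField ε) (x : ℝ) :
    HasDerivAt (fun s : ℝ => orbitStabilizer (f + s • coadjointVariation ε f) x)
      (ε x * deriv (orbitStabilizer f) x - deriv ε x * orbitStabilizer f x) 0 := by
  have hT := hasDerivAt_monodromyTrace_coadjoint hf hε
  have hg : ContDiff ℝ ∞ (deriv orbitLabel) := (contDiff_infty_iff_deriv.1 orbitLabel_spec.1).2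
  have hc := ((hg.differentiable (by simp) _).hasDerivAt.comp (0 : ℝ) hT).const_mul (2 * Real.pi)
  have hk : deriv (orbitStabilizer f) x = 2 * Real.pi * deriv orbitLabel (monodromyTrace f)
      * deriv (monodromyStabilizer f) x := by
    have := ((hasDerivAt_of_contDiff (isCircleField_monodromyStabilizer hf).smooth x).1.const_mul
      (2 * Real.pi * deriv orbitLabel (monodromyTrace f))).deriv
    exact this
  refine (hc.mul (hasDerivAt_monodromyStabilizer_coadjoint hf hε x)).congr_deriv ?_
  rw [hk]
  simp only [orbitStabilizer, Pi.smul_apply, smul_eq_mul, zero_smul, add_zero, mul_zero, zero_mul,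
    zero_add, Function.comp_apply]
  ring

/-! ### Coadjoint orbits -/

theorem IsCircleDiffeo.periodic_deriv {h : ℝ → ℝ} (hh : IsCircleDiffeo h) :
    Function.Periodic (deriv h) (2 * Real.pi) := fun x => by
  rw [← deriv_comp_add_const, funext hh.equivariant, deriv_add_const]

theorem continuous_coadjointAction {f h : ℝ → ℝ} (hf : Continuous f) (hh : IsCircleDiffeo h) :
    Continuous (coadjointAction h f) := by
  have hc : ∀ n : ℕ, Continuous (iteratedDeriv n h) := fun n =>
    hh.smooth.continuous_iteratedDeriv n (by exact_mod_cast le_top)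
  have h1 : Continuous (deriv h) := by simpa using hc 1
  have h0 : ∀ x, deriv h x ≠ 0 := fun x => (hh.deriv_pos x).ne'
  exact ((h1.pow 2).mul (hf.comp hh.smooth.continuous)).sub
    ((((hc 3).div h1 h0).sub ((((hc 2).pow 2).const_mul 3).div ((h1.pow 2).const_mul 2) fun x => by
      simpa using h0 x)).div_const 2)

/-- Solutions of Hill's equation transform as densities of weight `-1/2`: if `y'' = f y`, then
`u = (h')^{-1/2} y ∘ h` solves Hill's equation for the transformed potential. -/
theorem isForcedHillPair_coadjointAction {f h : ℝ → ℝ} (hf : Continuous f) (hh : IsCircleDiffeo h)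
    (a b : ℝ) :
    IsForcedHillPair (coadjointAction h f) 0
      (fun x => (√(deriv h x))⁻¹ * hillSol f a b (h x))
      (fun x => -(1 / 2) * iteratedDeriv 2 h x * (√(deriv h x))⁻¹ ^ 3 * hillSol f a b (h x)
        + √(deriv h x) * hillVel f a b (h x)) := by
  have hsqrt : ∀ x, HasDerivAt (fun x => √(deriv h x))
      (1 / 2 * iteratedDeriv 2 h x * (√(deriv h x))⁻¹) x := fun x => by
    refine ((hasDerivAt_of_contDiff hh.smooth x).2.1.sqrt (hh.deriv_pos x).ne').congr_deriv ?_
    have := (Real.sqrt_pos.2 (hh.deriv_pos x)).ne'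
    field_simp
  have hρ : ∀ x, HasDerivAt (fun x => (√(deriv h x))⁻¹)
      (-(1 / 2) * iteratedDeriv 2 h x * (√(deriv h x))⁻¹ ^ 3) x := fun x => by
    refine ((hsqrt x).inv (Real.sqrt_pos.2 (hh.deriv_pos x)).ne').congr_deriv ?_
    have := (Real.sqrt_pos.2 (hh.deriv_pos x)).ne'
    field_simp
  have hy : ∀ x, HasDerivAt (fun x => hillSol f a b (h x)) (hillVel f a b (h x) * deriv h x) x :=
    fun x => (hasDerivAt_hillSol hf a b (h x)).comp x (hasDerivAt_of_contDiff hh.smooth x).1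
  have hv : ∀ x, HasDerivAt (fun x => hillVel f a b (h x))
      (f (h x) * hillSol f a b (h x) * deriv h x) x :=
    fun x => (hasDerivAt_hillVel hf a b (h x)).comp x (hasDerivAt_of_contDiff hh.smooth x).1
  constructor
  · intro x
    refine ((hρ x).mul (hy x)).congr_deriv ?_
    have h0 := (Real.sqrt_pos.2 (hh.deriv_pos x)).ne'
    have hsq := Real.sq_sqrt (hh.deriv_pos x).le
    set q := √(deriv h x)
    rw [← hsq]
    field_simp
  · intro x
    refine (((((hasDerivAt_of_contDiff hh.smooth x).2.2.const_mul (-(1 / 2))).mul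
      ((hρ x).pow 3)).mul (hy x)).add ((hsqrt x).mul (hv x))).congr_deriv ?_
    have h0 := (Real.sqrt_pos.2 (hh.deriv_pos x)).ne'
    have hsq := Real.sq_sqrt (hh.deriv_pos x).le
    simp only [coadjointAction, schwarzian, Pi.zero_apply, Pi.mul_apply, Pi.pow_apply,
      Nat.cast_ofNat, Nat.add_one_sub_one]
    set q := √(deriv h x)
    rw [← hsq]
    field_simp
    ring

/-- The monodromy matrices of potentials on one coadjoint orbit are conjugate. -/
theorem monodromyTrace_coadjointAction {f h : ℝ → ℝ} (hf : IsCircleField f)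
    (hh : IsCircleDiffeo h) : monodromyTrace (coadjointAction h f) = monodromyTrace f := by
  have hfc := hf.continuous
  have hgc := continuous_coadjointAction hfc hh
  have h1 := (isForcedHillPair_coadjointAction hfc hh 1 0).eq_fundamental hgc (2 * Real.pi)
  have h2 := (isForcedHillPair_coadjointAction hfc hh 0 1).eq_fundamental hgc (2 * Real.pi)
  have e0 : h (2 * Real.pi) = h 0 + 2 * Real.pi := by simpa using hh.equivariant 0
  have e1 := hh.periodic_deriv.eq
  have e2 : iteratedDeriv 2 h (2 * Real.pi) = iteratedDeriv 2 h 0 := by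
    rw [iteratedDeriv_succ, iteratedDeriv_one]
    exact (Banados.periodic_deriv hh.periodic_deriv).eq
  simp only [e0, e1, e2, (hillSol_add_two_pi hf _ _ (h 0)).1,
    (hillSol_add_two_pi hf _ _ (h 0)).2] at h1 h2
  have hW := hill_wronskian hfc (h 0)
  have hq : (√(deriv h 0))⁻¹ * √(deriv h 0) = 1 :=
    inv_mul_cancel₀ (Real.sqrt_pos.2 (hh.deriv_pos 0)).ne'
  obtain ⟨h11, h12⟩ := h1
  obtain ⟨h21, h22⟩ := h2
  simp only [monodromyTrace]
  set q := √(deriv h 0)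
  set p := (√(deriv h 0))⁻¹
  set d := -(1 / 2) * iteratedDeriv 2 h 0 * p ^ 3
  set y₁ := hillSol f 1 0 (h 0)
  set y₂ := hillSol f 0 1 (h 0)
  set v₁ := hillVel f 1 0 (h 0)
  set v₂ := hillVel f 0 1 (h 0)
  -- The transformed solutions have Wronskian `1`, and in their basis the monodromy matrix of the
  -- transformed potential is that of `f`.
  have hdet : p * y₁ * (d * y₂ + q * v₂) - (d * y₁ + q * v₁) * (p * y₂) = 1 := by
    linear_combination (p * q) * hW + hq
  linear_combination (-(d * y₂ + q * v₂)) * h11 + (d * y₁ + q * v₁) * h21 + (p * y₂) * h12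
    - (p * y₁) * h22 - (hillSol (coadjointAction h f) 1 0 (2 * Real.pi)
      + hillVel (coadjointAction h f) 0 1 (2 * Real.pi)
      - hillSol f 1 0 (2 * Real.pi) - hillVel f 0 1 (2 * Real.pi)) * hdet

/-! ### The symmetry vector fields -/

/-- The components of `χ(ε; L)` in terms of the radius `r`, the values `a, a₁, a₂` of `ε_+` and its
first two derivatives, the values `b, b₁, b₂` of `ε_-` and its derivatives, and the values `A, B`
of `L_+` and `L_-`. -/
def chiValue (ℓ r a a₁ a₂ b b₁ b₂ A B : ℝ) : Coord :=
  ![-(r / 2) * (a₁ + b₁),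
    a + (ℓ ^ 2 * r ^ 2 * b₂ + ℓ ^ 4 * B * a₂) / (2 * (r ^ 4 - ℓ ^ 4 * A * B)),
    b + (ℓ ^ 2 * r ^ 2 * a₂ + ℓ ^ 4 * A * b₂) / (2 * (r ^ 4 - ℓ ^ 4 * A * B))]

/-- The differential of `chiValue`; a dot denotes the increment of the respective argument. -/
def chiIncrement (ℓ r a₁ a₂ b₁ b₂ A B dr da da₁ da₂ db db₁ db₂ dA dB : ℝ) : Coord :=
  ![-(dr / 2) * (a₁ + b₁) - r / 2 * (da₁ + db₁),
    da + ((ℓ ^ 2 * (2 * r * dr * b₂ + r ^ 2 * db₂) + ℓ ^ 4 * (dB * a₂ + B * da₂))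
        * (r ^ 4 - ℓ ^ 4 * A * B) - (ℓ ^ 2 * r ^ 2 * b₂ + ℓ ^ 4 * B * a₂)
        * (4 * r ^ 3 * dr - ℓ ^ 4 * (dA * B + A * dB))) / (2 * (r ^ 4 - ℓ ^ 4 * A * B) ^ 2),
    db + ((ℓ ^ 2 * (2 * r * dr * a₂ + r ^ 2 * da₂) + ℓ ^ 4 * (dA * b₂ + A * db₂))
        * (r ^ 4 - ℓ ^ 4 * A * B) - (ℓ ^ 2 * r ^ 2 * a₂ + ℓ ^ 4 * A * b₂)
        * (4 * r ^ 3 * dr - ℓ ^ 4 * (dA * B + A * dB))) / (2 * (r ^ 4 - ℓ ^ 4 * A * B) ^ 2)]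

theorem hasDerivAt_chiValue {ℓ s dr da da₁ da₂ db db₁ db₂ dA dB : ℝ}
    {r a a₁ a₂ b b₁ b₂ A B : ℝ → ℝ} (hr : HasDerivAt r dr s)
    (ha : HasDerivAt a da s) (ha₁ : HasDerivAt a₁ da₁ s) (ha₂ : HasDerivAt a₂ da₂ s)
    (hb : HasDerivAt b db s) (hb₁ : HasDerivAt b₁ db₁ s) (hb₂ : HasDerivAt b₂ db₂ s)
    (hA : HasDerivAt A dA s) (hB : HasDerivAt B dB s) (h0 : r s ^ 4 - ℓ ^ 4 * A s * B s ≠ 0) :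
    HasDerivAt
      (fun t => chiValue ℓ (r t) (a t) (a₁ t) (a₂ t) (b t) (b₁ t) (b₂ t) (A t) (B t))
      (chiIncrement ℓ (r s) (a₁ s) (a₂ s) (b₁ s) (b₂ s) (A s) (B s)
        dr da da₁ da₂ db db₁ db₂ dA dB) s := by
  have hΔ := ((hr.pow 4).sub ((hA.const_mul (ℓ ^ 4)).mul hB)).const_mul 2
  have h0' : (2 * (r s ^ 4 - ℓ ^ 4 * A s * B s)) ≠ 0 := mul_ne_zero two_ne_zero h0
  refine hasDerivAt_pi.2 fun i => ?_
  fin_cases i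
  · refine ((hr.div_const 2).neg.mul (ha₁.add hb₁)).congr_deriv ?_
    simp [chiIncrement]
    ring
  · refine (ha.add (((((hr.pow 2).const_mul (ℓ ^ 2)).mul hb₂).add
      ((hB.const_mul (ℓ ^ 4)).mul ha₂)).div hΔ h0')).congr_deriv ?_
    simp [chiIncrement]
    field_simp
  · refine (hb.add (((((hr.pow 2).const_mul (ℓ ^ 2)).mul ha₂).add
      ((hA.const_mul (ℓ ^ 4)).mul hb₂)).div hΔ h0')).congr_deriv ?_
    simp [chiIncrement]
    field_simp

theorem chi_eq_chiValue (ℓ : ℝ) (ε L : Fields) (p : Coord) :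
    chi ℓ ε L p = chiValue ℓ (p 0) (ε .plus (p 1)) (deriv (ε .plus) (p 1))
      (iteratedDeriv 2 (ε .plus) (p 1)) (ε .minus (p 2)) (deriv (ε .minus) (p 2))
      (iteratedDeriv 2 (ε .minus) (p 2)) (L .plus (p 1)) (L .minus (p 2)) := rfl

theorem sub_ne_zero_of_mem_patch {ℓ : ℝ} {L : Fields} {p : Coord} (hp : p ∈ patch ℓ L) :
    p 0 ^ 4 - ℓ ^ 4 * L .plus (p 1) * L .minus (p 2) ≠ 0 := sub_ne_zero.2 hp.2

theorem contDiffAt_chi {ℓ : ℝ} {ε L : Fields} (hε : ∀ σ, ContDiff ℝ ∞ (ε σ))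
    (hL : ∀ σ, ContDiff ℝ ∞ (L σ)) {p : Coord} (hp : p ∈ patch ℓ L) :
    ContDiffAt ℝ ∞ (chi ℓ ε L) p := by
  have hc : ∀ i, ContDiffAt ℝ ∞ (fun q : Coord => q i) p := fun i =>
    (contDiff_apply ℝ ℝ i).contDiffAt
  have hd : ∀ σ (n : ℕ) i, ContDiffAt ℝ ∞ (fun q : Coord => iteratedDeriv n (ε σ) (q i)) p := by
    intro σ n i
    have h : ContDiff ℝ ∞ (iteratedDeriv n (ε σ)) := by
      rw [iteratedDeriv_eq_iterate]
      exact (hε σ).iterate_deriv n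
    exact h.contDiffAt.comp p (hc i)
  have hLc : ∀ σ i, ContDiffAt ℝ ∞ (fun q : Coord => L σ (q i)) p := fun σ i =>
    (hL σ).contDiffAt.comp p (hc i)
  have hΔ : ContDiffAt ℝ ∞ (fun q : Coord =>
      2 * (q 0 ^ 4 - ℓ ^ 4 * L .plus (q 1) * L .minus (q 2))) p :=
    contDiffAt_const.mul (((hc 0).pow 4).sub ((contDiffAt_const.mul (hLc _ 1)).mul (hLc _ 2)))
  have h0 := mul_ne_zero two_ne_zero (sub_ne_zero_of_mem_patch hp)
  have hd0 := fun σ => hd σ 0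
  have hd1 := fun σ => hd σ 1
  simp only [iteratedDeriv_zero, iteratedDeriv_one] at hd0 hd1
  refine contDiffAt_pi.2 fun i => ?_
  fin_cases i
  · exact ((hc 0).div_const 2).neg.mul ((hd1 _ 1).add (hd1 _ 2))
  · exact (hd0 _ 1).add (((((contDiffAt_const.mul ((hc 0).pow 2)).mul (hd _ 2 2)).add
      ((contDiffAt_const.mul (hLc _ 2)).mul (hd _ 2 1)))).div hΔ h0)
  · exact (hd0 _ 2).add (((((contDiffAt_const.mul ((hc 0).pow 2)).mul (hd _ 2 1)).add
      ((contDiffAt_const.mul (hLc _ 1)).mul (hd _ 2 2)))).div hΔ h0)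

theorem hasDerivAt_line (p v : Coord) (i : Fin 3) :
    HasDerivAt (fun t : ℝ => (p + t • v) i) (v i) 0 := by
  simpa using ((hasDerivAt_id (0 : ℝ)).mul_const (v i)).const_add (p i)

theorem hasDerivAt_comp_line {f : ℝ → ℝ} {f' : ℝ} (p v : Coord) (i : Fin 3)
    (hf : HasDerivAt f f' (p i)) : HasDerivAt (fun t : ℝ => f ((p + t • v) i)) (f' * v i) 0 :=
  HasDerivAt.comp (h₂ := f) (0 : ℝ) (by simpa using hf) (hasDerivAt_line p v i)

theorem fderiv_eq_of_hasDerivAt_line {V : Type} [NormedAddCommGroup V] [NormedSpace ℝ V]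
    {f : Coord → V} {p v : Coord} {d : V} (hf : DifferentiableAt ℝ f p)
    (h : HasDerivAt (fun t : ℝ => f (p + t • v)) d 0) : fderiv ℝ f p v = d := by
  rw [← hf.lineDeriv_eq_fderiv]
  exact h.deriv

theorem fderiv_chi {ℓ : ℝ} {ε L : Fields} (hε : ∀ σ, ContDiff ℝ ∞ (ε σ))
    (hL : ∀ σ, ContDiff ℝ ∞ (L σ)) {p : Coord} (hp : p ∈ patch ℓ L) (v : Coord) :
    fderiv ℝ (chi ℓ ε L) p v = chiIncrement ℓ (p 0) (deriv (ε .plus) (p 1))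
      (iteratedDeriv 2 (ε .plus) (p 1)) (deriv (ε .minus) (p 2))
      (iteratedDeriv 2 (ε .minus) (p 2)) (L .plus (p 1)) (L .minus (p 2)) (v 0)
      (deriv (ε .plus) (p 1) * v 1) (iteratedDeriv 2 (ε .plus) (p 1) * v 1)
      (iteratedDeriv 3 (ε .plus) (p 1) * v 1)
      (deriv (ε .minus) (p 2) * v 2) (iteratedDeriv 2 (ε .minus) (p 2) * v 2)
      (iteratedDeriv 3 (ε .minus) (p 2) * v 2)
      (deriv (L .plus) (p 1) * v 1) (deriv (L .minus) (p 2) * v 2) := by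
  refine fderiv_eq_of_hasDerivAt_line ((contDiffAt_chi hε hL hp).differentiableAt (by simp)) ?_
  obtain ⟨a1, a2, a3⟩ := hasDerivAt_of_contDiff (hε .plus) (p 1)
  obtain ⟨b1, b2, b3⟩ := hasDerivAt_of_contDiff (hε .minus) (p 2)
  have hA := (hasDerivAt_of_contDiff (hL .plus) (p 1)).1
  have hB := (hasDerivAt_of_contDiff (hL .minus) (p 2)).1
  have := hasDerivAt_chiValue (ℓ := ℓ) (hasDerivAt_line p v 0)
    (hasDerivAt_comp_line p v 1 a1) (hasDerivAt_comp_line p v 1 a2) (hasDerivAt_comp_line p v 1 a3)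
    (hasDerivAt_comp_line p v 2 b1) (hasDerivAt_comp_line p v 2 b2) (hasDerivAt_comp_line p v 2 b3)
    (hasDerivAt_comp_line p v 1 hA) (hasDerivAt_comp_line p v 2 hB)
    (by simpa using sub_ne_zero_of_mem_patch hp)
  simp only [zero_smul, add_zero] at this
  exact this

/-- Algebraic core of the bracket relation: if `b`, `d` solve the stabilizer equations for `A`, `B`,
then the commutator of the fields with the parameters `(a, c)` and `(b, d)` is the variation of the
latter field, the parameters varying by the Witt bracket and `A`, `B` by the coadjoint action. -/
theorem chiIncrement_sub_chiIncrement
    {ℓ r a a₁ a₂ a₃ c c₁ c₂ c₃ b b₁ b₂ d d₁ d₂ A A₁ B B₁ : ℝ} (h0 : r ^ 4 - ℓ ^ 4 * A * B ≠ 0)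
    {V W : Coord} (hV : V = chiValue ℓ r a a₁ a₂ c c₁ c₂ A B)
    (hW : W = chiValue ℓ r b b₁ b₂ d d₁ d₂ A B) :
    chiIncrement ℓ r b₁ b₂ d₁ d₂ A B (V 0) (b₁ * V 1) (b₂ * V 1) ((4 * A * b₁ + 2 * b * A₁) * V 1)
        (d₁ * V 2) (d₂ * V 2) ((4 * B * d₁ + 2 * d * B₁) * V 2) (A₁ * V 1) (B₁ * V 2)
      - chiIncrement ℓ r a₁ a₂ c₁ c₂ A B (W 0) (a₁ * W 1) (a₂ * W 1) (a₃ * W 1)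
        (c₁ * W 2) (c₂ * W 2) (c₃ * W 2) (A₁ * W 1) (B₁ * W 2)
      = chiIncrement ℓ r b₁ b₂ d₁ d₂ A B 0 (a * b₁ - a₁ * b) (a * b₂ - a₂ * b)
        (a * (4 * A * b₁ + 2 * b * A₁) + a₁ * b₂ - a₂ * b₁ - a₃ * b)
        (c * d₁ - c₁ * d) (c * d₂ - c₂ * d)
        (c * (4 * B * d₁ + 2 * d * B₁) + c₁ * d₂ - c₂ * d₁ - c₃ * d)
        (a * A₁ + 2 * A * a₁ - a₃ / 2) (c * B₁ + 2 * B * c₁ - c₃ / 2) := by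
  subst hV hW
  simp only [chiIncrement, chiValue]
  generalize hD : r ^ 4 - ℓ ^ 4 * A * B = D at h0 ⊢
  ext i
  fin_cases i
  · simp
    ring
  · simp
    field_simp
    rw [← hD]
    ring
  · simp
    field_simp
    rw [← hD]
    ring

/-! ### The Lie derivative of the metric -/

/-- The components of the metric in terms of the radius `r` and the values `A`, `B` of `L_+` and
`L_-`. -/
def metricValue (ℓ r A B : ℝ) : Matrix (Fin 3) (Fin 3) ℝ :=
  !![ℓ ^ 2 / r ^ 2, 0, 0;
     0, ℓ ^ 2 * A, -(r ^ 2 + ℓ ^ 4 * A * B / r ^ 2) / 2;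
     0, -(r ^ 2 + ℓ ^ 4 * A * B / r ^ 2) / 2, ℓ ^ 2 * B]

/-- The differential of `metricValue` with respect to all of its arguments. -/
def metricIncrement (ℓ r A B dr dA dB : ℝ) : Matrix (Fin 3) (Fin 3) ℝ :=
  !![-2 * ℓ ^ 2 * dr / r ^ 3, 0, 0;
     0, ℓ ^ 2 * dA,
      -(2 * r * dr + ℓ ^ 4 * (dA * B + A * dB) / r ^ 2 - 2 * ℓ ^ 4 * A * B * dr / r ^ 3) / 2;
     0, -(2 * r * dr + ℓ ^ 4 * (dA * B + A * dB) / r ^ 2 - 2 * ℓ ^ 4 * A * B * dr / r ^ 3) / 2,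
      ℓ ^ 2 * dB]

theorem metric_eq_metricValue (ℓ : ℝ) (L : Fields) (p : Coord) :
    metric ℓ L p = metricValue ℓ (p 0) (L .plus (p 1)) (L .minus (p 2)) := rfl

theorem fderiv_metric {ℓ : ℝ} {L : Fields} (hL : ∀ σ, ContDiff ℝ ∞ (L σ)) {p : Coord}
    (hp : p 0 ≠ 0) (v : Coord) (μ ν : Fin 3) :
    fderiv ℝ (fun q => metric ℓ L q μ ν) p v = metricIncrement ℓ (p 0) (L .plus (p 1))
      (L .minus (p 2)) (v 0) (deriv (L .plus) (p 1) * v 1) (deriv (L .minus) (p 2) * v 2) μ ν := by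
  have hc : ∀ i, ContDiffAt ℝ 1 (fun q : Coord => q i) p := fun i =>
    (contDiff_apply ℝ ℝ i).contDiffAt
  have hLc : ∀ σ i, ContDiffAt ℝ 1 (fun q : Coord => L σ (q i)) p := fun σ i =>
    ((hL σ).of_le (by simp)).contDiffAt.comp p (hc i)
  have hr := hasDerivAt_line p v 0
  have hA := hasDerivAt_comp_line p v 1 (hasDerivAt_of_contDiff (hL .plus) (p 1)).1
  have hB := hasDerivAt_comp_line p v 2 (hasDerivAt_of_contDiff (hL .minus) (p 2)).1
  have hp' : (p + (0 : ℝ) • v) 0 ^ 2 ≠ 0 := by simpa using hp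
  have hoff : fderiv ℝ (fun q : Coord =>
      -(q 0 ^ 2 + ℓ ^ 4 * L .plus (q 1) * L .minus (q 2) / q 0 ^ 2) / 2) p v
      = metricIncrement ℓ (p 0) (L .plus (p 1)) (L .minus (p 2)) (v 0)
        (deriv (L .plus) (p 1) * v 1) (deriv (L .minus) (p 2) * v 2) 1 2 := by
    refine fderiv_eq_of_hasDerivAt_line (ContDiffAt.differentiableAt (n := 1)
      ((((hc 0).pow 2).add ((((contDiffAt_const.mul (hLc .plus 1)).mul (hLc .minus 2))).div
        ((hc 0).pow 2) (pow_ne_zero 2 hp))).neg.div_const 2) one_ne_zero) ?_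
    refine ((((hr.pow 2).add (((hA.const_mul (ℓ ^ 4)).mul hB).div (hr.pow 2) hp')).neg).div_const
      2).congr_deriv ?_
    simp [metricIncrement]
    field_simp
    ring
  have hzero : fderiv ℝ (fun _ : Coord => (0 : ℝ)) p v = 0 := by simp
  fin_cases μ <;> fin_cases ν
  · refine fderiv_eq_of_hasDerivAt_line
      (ContDiffAt.differentiableAt (n := 1)
        (contDiffAt_const.div ((hc 0).pow 2) (pow_ne_zero 2 hp)) one_ne_zero) ?_
    refine ((hasDerivAt_const (0 : ℝ) (ℓ ^ 2)).div (hr.pow 2) hp').congr_deriv ?_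
    simp [metricIncrement]
    field_simp
  · exact hzero
  · exact hzero
  · exact hzero
  · exact fderiv_eq_of_hasDerivAt_line (((hLc .plus 1).differentiableAt one_ne_zero).const_mul (ℓ ^ 2))
      (hA.const_mul (ℓ ^ 2))
  · exact hoff
  · exact hzero
  · exact hoff
  · exact fderiv_eq_of_hasDerivAt_line (((hLc .minus 2).differentiableAt one_ne_zero).const_mul (ℓ ^ 2))
      (hB.const_mul (ℓ ^ 2))

theorem fderiv_component {V : Coord → Coord} {p : Coord} (hV : DifferentiableAt ℝ V p) (v : Coord)
    (ρ : Fin 3) : fderiv ℝ (fun q => V q ρ) p v = fderiv ℝ V p v ρ := by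
  rw [(hasFDerivAt_pi'.1 hV.hasFDerivAt ρ).fderiv]
  rfl

/-- The field `χ(ε; L)` generates the coadjoint action: the Lie derivative of the metric is its
variation under `δ_ε L`. -/
theorem lieDerivative_metric_chi {ℓ : ℝ} {ε L : Fields} (hε : ∀ σ, ContDiff ℝ ∞ (ε σ))
    (hL : ∀ σ, ContDiff ℝ ∞ (L σ)) {p : Coord} (hp : p ∈ patch ℓ L) (μ ν : Fin 3) :
    lieDerivative (metric ℓ L) (chi ℓ ε L) p μ ν = metricIncrement ℓ (p 0) (L .plus (p 1))
      (L .minus (p 2)) 0 (deltaL ε L .plus (p 1)) (deltaL ε L .minus (p 2)) μ ν := by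
  have hd := (contDiffAt_chi hε hL hp).differentiableAt (by simp)
  have hr : p 0 ≠ 0 := hp.1.ne'
  have h0 := sub_ne_zero_of_mem_patch hp
  simp only [lieDerivative, fderiv_metric hL hr, fderiv_component hd, fderiv_chi hε hL hp]
  simp only [metric_eq_metricValue, chi_eq_chiValue, deltaL]
  generalize p 0 = r at hr h0 ⊢
  generalize L .plus (p 1) = A at h0 ⊢
  generalize L .minus (p 2) = B at h0 ⊢
  simp only [chiIncrement, chiValue]
  generalize hD : r ^ 4 - ℓ ^ 4 * A * B = D at h0 ⊢
  fin_cases μ <;> fin_cases ν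
  all_goals simp [Fin.sum_univ_three, metricIncrement, metricValue]
  all_goals try field_simp
  all_goals first | ring1 | (rw [← hD]; ring1)

/-! ### Killing vectors -/

theorem mem_patch_of_lt {ℓ : ℝ} {L : Fields} {r x y : ℝ} (h1 : 1 ≤ r)
    (h : ℓ ^ 4 * L .plus x * L .minus y < r) : ![r, x, y] ∈ patch ℓ L := by
  refine ⟨by simpa using by linarith, ?_⟩
  have : r ≤ r ^ 4 := le_self_pow₀ h1 (by norm_num)
  simpa using (h.trans_le this).ne'

theorem exists_mem_patch (ℓ : ℝ) (L : Fields) (x y : ℝ) :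
    ∃ r₀ : ℝ, 0 < r₀ ∧ ∀ r, r₀ ≤ r → ![r, x, y] ∈ patch ℓ L :=
  ⟨|ℓ ^ 4 * L .plus x * L .minus y| + 1, by positivity, fun r hr => mem_patch_of_lt
    (by linarith [abs_nonneg (ℓ ^ 4 * L .plus x * L .minus y)])
    (by linarith [le_abs_self (ℓ ^ 4 * L .plus x * L .minus y)])⟩

/-- The components of the Lie derivative along `x^+ x^+` and `x^- x^-` are `ℓ² δ_ε L_+` and
`ℓ² δ_ε L_-`, and every point of the circle lies under some point of the patch. -/
theorem isGlobalKilling_chi_iff {ℓ : ℝ} (hℓ : 0 < ℓ) {L ε : Fields} (hL : IsSingleValued L)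
    (hε : IsSingleValued ε) :
    IsGlobalKilling ℓ L (chi ℓ ε L) ↔ ∀ σ, IsStabilizer (L σ) (ε σ) := by
  have hεs := fun σ => (hε σ).smooth
  have hLs := fun σ => (hL σ).smooth
  constructor
  · intro h σ
    refine (isStabilizer_iff_coadjointVariation (hεs σ)).2 (funext fun x => ?_)
    cases σ with
    | plus =>
      obtain ⟨r, -, hr⟩ := exists_mem_patch ℓ L x 0
      have := h.killing _ (hr r le_rfl) 1 1
      rw [lieDerivative_metric_chi hεs hLs (hr r le_rfl)] at this
      simpa [metricIncrement, hℓ.ne', deltaL_apply] using this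
    | minus =>
      obtain ⟨r, -, hr⟩ := exists_mem_patch ℓ L 0 x
      have := h.killing _ (hr r le_rfl) 2 2
      rw [lieDerivative_metric_chi hεs hLs (hr r le_rfl)] at this
      simpa [metricIncrement, hℓ.ne', deltaL_apply] using this
  · intro h
    refine ⟨fun p hp => (contDiffAt_chi hεs hLs hp).contDiffWithinAt, fun p _ => ?_,
      fun p hp μ ν => ?_⟩
    · simp only [chi_eq_chiValue, Pi.add_apply, Matrix.cons_val_zero, Matrix.cons_val_one,
        Matrix.cons_val, add_zero, ← sub_eq_add_neg, (hL _).periodic _, (hε _).periodic _,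
        (hε _).deriv.periodic _, ((hε _).iteratedDeriv 2).periodic _, (hL _).periodic.sub_eq _,
        (hε _).periodic.sub_eq _, (hε _).deriv.periodic.sub_eq _,
        ((hε _).iteratedDeriv 2).periodic.sub_eq _]
    · rw [lieDerivative_metric_chi hεs hLs hp, deltaL_apply, deltaL_apply,
        (isStabilizer_iff_coadjointVariation (hεs _)).1 (h _),
        (isStabilizer_iff_coadjointVariation (hεs _)).1 (h _)]
      fin_cases μ <;> fin_cases ν <;> simp [metricIncrement]

theorem isCircleField_zero : IsCircleField 0 := ⟨contDiff_const, fun _ => rfl⟩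

theorem isStabilizer_zero (f : ℝ → ℝ) : IsStabilizer f 0 :=
  (isStabilizer_iff_coadjointVariation (k := 0) contDiff_const).2 (by
    ext x
    simp [coadjointVariation])

theorem isSingleValued_single {σ : Sector} {k : ℝ → ℝ} (hk : IsCircleField k) :
    IsSingleValued (Pi.single σ k : Fields) := fun τ => by
  rcases eq_or_ne τ σ with rfl | h
  · simpa using hk
  · simpa [h] using isCircleField_zero

theorem isStabilizer_single {L : Fields} {σ : Sector} {k : ℝ → ℝ} (hk : IsStabilizer (L σ) k)
    (τ : Sector) : IsStabilizer (L τ) ((Pi.single σ k : Fields) τ) := by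
  rcases eq_or_ne τ σ with rfl | h
  · simpa using hk
  · simpa [h] using isStabilizer_zero (L τ)

/-- Every circle field has a nonzero periodic stabilizer which is a product of two solutions of
Hill's equation: the monodromy stabilizer or, if that vanishes, the square of any solution. -/
theorem exists_ne_zero_isStabilizer {f : ℝ → ℝ} (hf : IsCircleField f) :
    ∃ k, IsCircleField k ∧ k ≠ 0 ∧ IsHillProduct f k ∧ IsStabilizer f k := by
  by_cases h : monodromyStabilizer f = 0
  · have hs := isStabilizer_hillForm hf.smooth 1 0 0
    refine ⟨hillForm f 1 0 0, ⟨hs.smooth, isExceptional_of_monodromyStabilizer_eq_zero hf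
      (fun x => congrFun h x) _ hs⟩, fun h0 => ?_, isHillProduct_hillForm hf.smooth _ _ _, hs⟩
    exact one_ne_zero (hillForm_eq_zero hf.continuous (congrFun h0)).1
  · exact ⟨_, isCircleField_monodromyStabilizer hf, h, isHillProduct_hillForm hf.smooth _ _ _,
      isStabilizer_hillForm hf.smooth _ _ _⟩

theorem eq_zero_of_quartic {α β γ r₀ : ℝ} (h0 : 0 < r₀)
    (h : ∀ r, r₀ ≤ r → α * r ^ 4 + β * r ^ 2 + γ = 0) : α = 0 := by
  -- The second divided difference in `r²`, at `r₀`, `2 r₀`, `3 r₀`, isolates `α`.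
  have e1 := h r₀ le_rfl
  have e2 := h (2 * r₀) (by linarith)
  have e3 := h (3 * r₀) (by linarith)
  have : α * r₀ ^ 4 = 0 := by linear_combination e1 / 24 - e2 / 15 + e3 / 40
  exact (mul_eq_zero.1 this).resolve_right (pow_pos h0 4).ne'

/-- The leading behaviour at large radius separates the two Killing vectors. -/
theorem chi_single_linearIndependent {ℓ : ℝ} {L k : Fields} (hk : ∀ σ, k σ ≠ 0) (a b : ℝ)
    (h : ∀ p ∈ patch ℓ L, a • chi ℓ (Pi.single .plus (k .plus)) L p
      + b • chi ℓ (Pi.single .minus (k .minus)) L p = 0) : a = 0 ∧ b = 0 := by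
  constructor
  · obtain ⟨x, hx⟩ := Function.ne_iff.1 (hk .plus)
    obtain ⟨r₀, hr₀, hr⟩ := exists_mem_patch ℓ L x 0
    have h1 : 2 * a * k .plus x = 0 := by
      refine eq_zero_of_quartic (β := b * (ℓ ^ 2 * iteratedDeriv 2 (k .minus) 0))
        (γ := a * (ℓ ^ 4 * L .minus 0 * iteratedDeriv 2 (k .plus) x)
          - 2 * a * k .plus x * (ℓ ^ 4 * L .plus x * L .minus 0)) hr₀ fun r hrr => ?_
      have h2 := congrFun (h _ (hr r hrr)) 1
      have h0 := sub_ne_zero_of_mem_patch (hr r hrr)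
      simp only [chi] at h2
      simp at h2 h0
      generalize hD : r ^ 4 - ℓ ^ 4 * L .plus x * L .minus 0 = D at h0 h2
      field_simp at h2
      rw [← hD] at h2
      linear_combination h2
    simpa [show k .plus x ≠ 0 from hx] using h1
  · obtain ⟨x, hx⟩ := Function.ne_iff.1 (hk .minus)
    obtain ⟨r₀, hr₀, hr⟩ := exists_mem_patch ℓ L 0 x
    have h1 : 2 * b * k .minus x = 0 := by
      refine eq_zero_of_quartic (β := a * (ℓ ^ 2 * iteratedDeriv 2 (k .plus) 0))
        (γ := b * (ℓ ^ 4 * L .plus 0 * iteratedDeriv 2 (k .minus) x)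
          - 2 * b * k .minus x * (ℓ ^ 4 * L .plus 0 * L .minus x)) hr₀ fun r hrr => ?_
      have h2 := congrFun (h _ (hr r hrr)) 2
      have h0 := sub_ne_zero_of_mem_patch (hr r hrr)
      simp only [chi] at h2
      simp at h2 h0
      generalize hD : r ^ 4 - ℓ ^ 4 * L .plus 0 * L .minus x = D at h0 h2
      field_simp at h2
      rw [← hD] at h2
      linear_combination h2
    simpa [show k .minus x ≠ 0 from hx] using h1

/-! ### The adjusted bracket -/

/-- The Witt bracket of vector fields on the line. -/
def wittBracket (a b : ℝ → ℝ) (x : ℝ) : ℝ := a x * deriv b x - deriv a x * b x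

theorem hasDerivAt_wittBracket {a b : ℝ → ℝ} (ha : ContDiff ℝ ∞ a) (hb : ContDiff ℝ ∞ b) (x : ℝ) :
    HasDerivAt (wittBracket a b) (a x * iteratedDeriv 2 b x - iteratedDeriv 2 a x * b x) x := by
  obtain ⟨a1, a2, -⟩ := hasDerivAt_of_contDiff ha x
  obtain ⟨b1, b2, -⟩ := hasDerivAt_of_contDiff hb x
  exact ((a1.mul b2).sub (a2.mul b1)).congr_deriv (by ring)

theorem iteratedDeriv_two_wittBracket {a b : ℝ → ℝ} (ha : ContDiff ℝ ∞ a) (hb : ContDiff ℝ ∞ b)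
    (x : ℝ) : iteratedDeriv 2 (wittBracket a b) x = a x * iteratedDeriv 3 b x
      + deriv a x * iteratedDeriv 2 b x - iteratedDeriv 2 a x * deriv b x
      - iteratedDeriv 3 a x * b x := by
  rw [iteratedDeriv_two_of_hasDerivAt (hasDerivAt_wittBracket ha hb) (fun x => ?_)]
  obtain ⟨a1, -, a3⟩ := hasDerivAt_of_contDiff ha x
  obtain ⟨b1, -, b3⟩ := hasDerivAt_of_contDiff hb x
  exact ((a1.mul b3).sub (a3.mul b1)).congr_deriv (by ring)

/-- The commutator with a Killing vector `χ(κ; L)` is the variation of the latter under which `κ`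
changes by its Witt bracket with `ε` and `L` by `δ_ε L`. -/
theorem lieBracket_chi {ℓ : ℝ} {ε κ L : Fields} (hε : ∀ σ, ContDiff ℝ ∞ (ε σ))
    (hL : ∀ σ, ContDiff ℝ ∞ (L σ)) (hκ : ∀ σ, IsStabilizer (L σ) (κ σ)) {p : Coord}
    (hp : p ∈ patch ℓ L) :
    VectorField.lieBracket ℝ (chi ℓ ε L) (chi ℓ κ L) p
      = chiIncrement ℓ (p 0) (deriv (κ .plus) (p 1)) (iteratedDeriv 2 (κ .plus) (p 1))
        (deriv (κ .minus) (p 2)) (iteratedDeriv 2 (κ .minus) (p 2)) (L .plus (p 1))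
        (L .minus (p 2)) 0
        (wittBracket (ε .plus) (κ .plus) (p 1)) (deriv (wittBracket (ε .plus) (κ .plus)) (p 1))
        (iteratedDeriv 2 (wittBracket (ε .plus) (κ .plus)) (p 1))
        (wittBracket (ε .minus) (κ .minus) (p 2)) (deriv (wittBracket (ε .minus) (κ .minus)) (p 2))
        (iteratedDeriv 2 (wittBracket (ε .minus) (κ .minus)) (p 2))
        (deltaL ε L .plus (p 1)) (deltaL ε L .minus (p 2)) := by
  have hκs := fun σ => (hκ σ).smooth
  have h3 : ∀ σ x, iteratedDeriv 3 (κ σ) x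
      = 4 * L σ x * deriv (κ σ) x + 2 * κ σ x * deriv (L σ) x := fun σ x => by
    linarith [(hκ σ).eqn x]
  simp only [VectorField.lieBracket, fderiv_chi hε hL hp, fderiv_chi hκs hL hp,
    iteratedDeriv_two_wittBracket (hε _) (hκs _), (hasDerivAt_wittBracket (hε _) (hκs _) _).deriv,
    wittBracket, h3, deltaL]
  exact chiIncrement_sub_chiIncrement (sub_ne_zero_of_mem_patch hp) (chi_eq_chiValue ..)
    (chi_eq_chiValue ..)

theorem chiIncrement_zero (ℓ r a₁ a₂ b₁ b₂ A B : ℝ) :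
    chiIncrement ℓ r a₁ a₂ b₁ b₂ A B 0 0 0 0 0 0 0 0 0 = 0 := by
  ext i
  fin_cases i <;> simp [chiIncrement]

theorem lieBracket_chi_single {ℓ : ℝ} {L : Fields} {a b : ℝ → ℝ} (hL : ∀ σ, ContDiff ℝ ∞ (L σ))
    (ha : IsStabilizer (L .plus) a) (hb : IsStabilizer (L .minus) b) {p : Coord}
    (hp : p ∈ patch ℓ L) :
    VectorField.lieBracket ℝ (chi ℓ (Pi.single .plus a) L) (chi ℓ (Pi.single .minus b) L) p = 0 := by
  have h1 : wittBracket a 0 = fun _ => 0 := funext fun x => by simp [wittBracket]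
  have h2 : wittBracket 0 b = fun _ => 0 := funext fun x => by simp [wittBracket]
  have hs := fun τ => isStabilizer_single (L := L) ha τ
  have hδ : ∀ τ, deltaL (Pi.single .plus a) L τ = 0 := fun τ => by
    rw [deltaL_apply]
    exact (isStabilizer_iff_coadjointVariation (hs τ).smooth).1 (hs τ)
  rw [lieBracket_chi (fun τ => (hs τ).smooth) hL (isStabilizer_single hb) hp, hδ, hδ]
  simp only [Pi.single_eq_same, Pi.single_eq_of_ne (show Sector.minus ≠ Sector.plus by simp),
    Pi.single_eq_of_ne (show Sector.plus ≠ Sector.minus by simp), h1, h2, Pi.zero_apply,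
    deriv_const', iteratedDeriv_const, OfNat.ofNat_ne_zero, if_false]
  exact chiIncrement_zero ..

/-- Exchange of the derivatives in the parameter and in the argument. -/
theorem hasDerivAt_deriv_right {H : ℝ → ℝ → ℝ} (hH : ContDiff ℝ ∞ (Function.uncurry H)) (s x : ℝ) :
    HasDerivAt (fun u => deriv (H u) x) (deriv (fun y => deriv (fun u => H u y) s) x) s := by
  obtain ⟨U, hUH⟩ : ∃ U, U = Function.uncurry H := ⟨_, rfl⟩
  have hHU : ∀ u y, H u y = U (u, y) := fun u y => by rw [hUH]; rfl
  rw [← hUH] at hH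
  have hUd : ∀ q, HasFDerivAt U (fderiv ℝ U q) q := fun q =>
    (hH.differentiable (by simp) q).hasFDerivAt
  have hU2 : ContDiff ℝ ∞ (fderiv ℝ U) := (contDiff_infty_iff_fderiv.1 hH).2
  have hUdd : HasFDerivAt (fderiv ℝ U) (fderiv ℝ (fderiv ℝ U) (s, x)) (s, x) :=
    (hU2.differentiable (by simp) _).hasFDerivAt
  have hl : ∀ u y : ℝ, HasDerivAt (fun u : ℝ => (u, y)) ((1 : ℝ), (0 : ℝ)) u := fun u y =>
    (hasDerivAt_id u).prodMk (hasDerivAt_const u y)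
  have hr : ∀ u y : ℝ, HasDerivAt (fun y : ℝ => (u, y)) ((0 : ℝ), (1 : ℝ)) y := fun u y =>
    (hasDerivAt_const y u).prodMk (hasDerivAt_id y)
  have h1 : ∀ u y, deriv (H u) y = fderiv ℝ U (u, y) (0, 1) := fun u y => by
    have := ((hUd (u, y)).comp_hasDerivAt y (hr u y)).deriv
    rw [← this]
    exact congrArg (deriv · y) (funext fun y => hHU u y)
  have h2 : ∀ u y, deriv (fun u => H u y) u = fderiv ℝ U (u, y) (1, 0) := fun u y => by
    have := ((hUd (u, y)).comp_hasDerivAt u (hl u y)).deriv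
    rw [← this]
    exact congrArg (deriv · u) (funext fun u => hHU u y)
  have h3 : HasDerivAt (fun u => fderiv ℝ U (u, x) (0, 1))
      (fderiv ℝ (fderiv ℝ U) (s, x) (1, 0) (0, 1)) s := by
    have h := hUdd.comp_hasDerivAt s (hl s x)
    simpa using h.clm_apply (hasDerivAt_const s ((0 : ℝ), (1 : ℝ)))
  have h4 : HasDerivAt (fun y => fderiv ℝ U (s, y) (1, 0))
      (fderiv ℝ (fderiv ℝ U) (s, x) (0, 1) (1, 0)) x := by
    have h := hUdd.comp_hasDerivAt x (hr s x)
    simpa using h.clm_apply (hasDerivAt_const x ((1 : ℝ), (0 : ℝ)))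
  have hsymm := second_derivative_symmetric hUd hUdd (1, 0) (0, 1)
  simp only [h1, h2]
  rw [h4.deriv, ← hsymm]
  exact h3

theorem contDiff_deriv_right {H : ℝ → ℝ → ℝ} (hH : ContDiff ℝ ∞ (Function.uncurry H)) :
    ContDiff ℝ ∞ (Function.uncurry fun s x => deriv (H s) x) :=
  (contDiff_deriv_left (F := fun x s => H s x) (hH.comp (contDiff_snd.prodMk contDiff_fst))).comp
    (contDiff_snd.prodMk contDiff_fst)

theorem hasDerivAt_chi_param {ℓ s₀ : ℝ} {e M : ℝ → Fields} {dM : Fields}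
    (he : ∀ σ, ContDiff ℝ ∞ (Function.uncurry fun s => e s σ))
    (hM : ∀ σ x, HasDerivAt (fun s => M s σ x) (dM σ x) s₀) {p : Coord}
    (hp : p ∈ patch ℓ (M s₀)) {w : Fields}
    (hw : ∀ σ x, deriv (fun s => e s σ x) s₀ = w σ x) :
    HasDerivAt (fun s => chi ℓ (e s) (M s) p)
      (chiIncrement ℓ (p 0) (deriv (e s₀ .plus) (p 1)) (iteratedDeriv 2 (e s₀ .plus) (p 1))
        (deriv (e s₀ .minus) (p 2)) (iteratedDeriv 2 (e s₀ .minus) (p 2)) (M s₀ .plus (p 1))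
        (M s₀ .minus (p 2)) 0
        (w .plus (p 1)) (deriv (w .plus) (p 1)) (iteratedDeriv 2 (w .plus) (p 1))
        (w .minus (p 2)) (deriv (w .minus) (p 2)) (iteratedDeriv 2 (w .minus) (p 2))
        (dM .plus (p 1)) (dM .minus (p 2))) s₀ := by
  have h0 : ∀ σ x, HasDerivAt (fun s => e s σ x) (w σ x) s₀ := fun σ x => by
    rw [← hw]
    exact hasDerivAt_left (he σ) s₀ x
  have h1 : ∀ σ x, HasDerivAt (fun s => deriv (e s σ) x) (deriv (w σ) x) s₀ := fun σ x => by
    rw [← funext (hw σ)]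
    exact hasDerivAt_deriv_right (he σ) s₀ x
  have h2 : ∀ σ x, HasDerivAt (fun s => iteratedDeriv 2 (e s σ) x) (iteratedDeriv 2 (w σ) x) s₀ := by
    intro σ x
    have := hasDerivAt_deriv_right (contDiff_deriv_right (he σ)) s₀ x
    rw [funext fun y => (h1 σ y).deriv] at this
    simpa only [iteratedDeriv_succ, iteratedDeriv_zero] using this
  exact hasDerivAt_chiValue (hasDerivAt_const s₀ (p 0)) (h0 _ _) (h1 _ _) (h2 _ _) (h0 _ _)
    (h1 _ _) (h2 _ _) (hM _ _) (hM _ _) (sub_ne_zero_of_mem_patch hp)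

/-- The field dependent Killing vectors commute with all symmetries in the adjusted bracket: the
variation of the Killing parameter along the coadjoint action is its Lie bracket with `ε`. -/
theorem adjustedBracket_killingParam {ℓ : ℝ} {L ε : Fields} (hL : IsSingleValued L)
    (hε : IsSingleValued ε) (σ : Sector) {p : Coord} (hp : p ∈ patch ℓ L) :
    adjustedBracket ℓ (fun _ => ε) (killingParam orbitStabilizer σ) L p = 0 := by
  have hδ : ∀ τ, IsCircleField (deltaL ε L τ) := fun τ =>
    isCircleField_coadjointVariation (hε τ) (hL τ)
  have hs : ∀ τ, IsStabilizer (L τ) (killingParam orbitStabilizer σ L τ) :=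
    isStabilizer_single (isStabilizer_orbitStabilizer (hL σ))
  have hzero : deltaL (killingParam orbitStabilizer σ L) L = 0 := funext fun τ =>
    (isStabilizer_iff_coadjointVariation (hs τ).smooth).1 (hs τ)
  have h2 : chiVariation ℓ (killingParam orbitStabilizer σ L) (fun _ => ε) L p = 0 := by
    simp [chiVariation, hzero]
  have h1 := hasDerivAt_chi_param (ℓ := ℓ) (s₀ := 0) (p := p)
    (e := fun s => killingParam orbitStabilizer σ (L + s • deltaL ε L))
    (M := fun s => L + s • deltaL ε L) (dM := deltaL ε L)
    (w := fun τ => wittBracket (ε τ) (killingParam orbitStabilizer σ L τ))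
    (fun τ => by
      rcases eq_or_ne τ σ with rfl | h
      · simpa [killingParam] using
          contDiff_orbitStabilizer (contDiff_add_smul (hL τ).smooth (hδ τ).smooth)
      · simpa [killingParam, h, Function.uncurry_def] using contDiff_const)
    (fun τ x => by
      simpa using ((hasDerivAt_id (0 : ℝ)).mul_const (deltaL ε L τ x)).const_add (L τ x))
    (by simpa using hp) (fun τ x => by
      rcases eq_or_ne τ σ with rfl | h
      · simpa [killingParam, wittBracket] using!
          (hasDerivAt_orbitStabilizer_coadjoint (hL τ) (hε τ) x).deriv
      · simp [wittBracket, killingParam, h])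
  simp only [zero_smul, add_zero] at h1
  rw [adjustedBracket, h2, sub_zero, chiVariation, h1.deriv,
    lieBracket_chi (fun τ => (hε τ).smooth) (fun τ => (hL τ).smooth) hs hp, sub_self]

/-! ### Charges -/

theorem integral_lightCone {V : Type} [NormedAddCommGroup V] [NormedSpace ℝ V] {g : ℝ → V}
    (hg : Function.Periodic g (2 * Real.pi)) (ℓ t : ℝ) (σ : Sector) :
    ∫ φ in (0 : ℝ)..(2 * Real.pi), g (lightCone ℓ t φ σ) = ∫ x in (0 : ℝ)..(2 * Real.pi), g x := by
  have h := fun a => hg.intervalIntegral_add_eq a 0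
  simp only [zero_add] at h
  cases σ with
  | plus =>
    simp only [lightCone, Sector.sign, one_mul]
    rw [intervalIntegral.integral_comp_add_left g, add_zero, h]
  | minus =>
    simp only [lightCone, Sector.sign, neg_mul, one_mul, ← sub_eq_add_neg]
    rw [intervalIntegral.integral_comp_sub_left g, sub_zero, ← h (t / ℓ - 2 * Real.pi),
      sub_add_cancel]

theorem chargeVariation_eq {k v : ℝ → ℝ} (hk : Function.Periodic k (2 * Real.pi))
    (hv : Function.Periodic v (2 * Real.pi)) (ℓ G t : ℝ) (σ : Sector) :
    chargeVariation ℓ G t σ k v = ℓ / (8 * Real.pi * G)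
      * ∫ x in (0 : ℝ)..(2 * Real.pi), k x * v x := by
  rw [chargeVariation]
  congr 1
  exact integral_lightCone (g := fun x => k x * v x) (hk.mul hv) ℓ t σ

theorem chargeVariation_coadjointVariation {f ε k : ℝ → ℝ} (hf : IsCircleField f)
    (hε : IsCircleField ε) (hk : IsCircleField k) (hs : IsStabilizer f k) (ℓ G t : ℝ)
    (σ : Sector) : chargeVariation ℓ G t σ k (coadjointVariation ε f) = 0 := by
  rw [chargeVariation_eq hk.periodic (isCircleField_coadjointVariation hε hf).periodic,
    integral_stabilizer_mul_coadjointVariation hf hε hk hs, mul_zero]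

/-- The Killing charge as a functional on the phase space of one sector. The additive constant is
fixed by the value `0` at the potential `0`. -/
def killingCharge (ℓ G : ℝ) (f : ℝ → ℝ) : ℝ := ℓ / (4 * G) * orbitLabel (monodromyTrace f)

theorem periodic_deriv_left {F : ℝ → ℝ → ℝ} (hF : ∀ s, IsCircleField (F s)) (s : ℝ) :
    Function.Periodic (fun x => deriv (fun u => F u x) s) (2 * Real.pi) := fun x => by
  simp only [(hF _).periodic x]

theorem hasDerivAt_killingCharge {ℓ G : ℝ} (hG : G ≠ 0) {F : ℝ → ℝ → ℝ}
    (hF : ContDiff ℝ ∞ (Function.uncurry F)) (hFc : ∀ s, IsCircleField (F s)) (σ : Sector)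
    (t s : ℝ) :
    HasDerivAt (fun u => killingCharge ℓ G (F u))
      (chargeVariation ℓ G t σ (orbitStabilizer (F s)) (fun x => deriv (fun u => F u x) s)) s := by
  refine ((hasDerivAt_orbitLabel hF s).const_mul (ℓ / (4 * G))).congr_deriv ?_
  rw [chargeVariation_eq (isCircleField_orbitStabilizer (hFc s)).periodic
    (periodic_deriv_left hFc s)]
  have := Real.pi_ne_zero
  field_simp
  ring

theorem killingCharge_coadjointAction (ℓ G : ℝ) {f h : ℝ → ℝ} (hf : IsCircleField f)
    (hh : IsCircleDiffeo h) :
    killingCharge ℓ G (coadjointAction h f) = killingCharge ℓ G f := by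
  rw [killingCharge, monodromyTrace_coadjointAction hf hh, killingCharge]

theorem killingCharge_const (ℓ G : ℝ) {c : ℝ} (hc : 0 ≤ c) :
    killingCharge ℓ G (fun _ => c) = ℓ / (4 * G) * c := by
  rw [killingCharge, (orbitLabel_spec.2.2 c hc).1]

theorem isCircleField_const (c : ℝ) : IsCircleField fun _ => c := ⟨contDiff_const, fun _ => rfl⟩

/-- Differentiation of the pairing with a fixed variation, under the integral sign. -/
theorem hasDerivAt_chargeVariation {F : ℝ → ℝ → ℝ} (hF : ContDiff ℝ ∞ (Function.uncurry F))
    (hFc : ∀ s, IsCircleField (F s)) {v : ℝ → ℝ} (hv : IsCircleField v) (ℓ G t : ℝ) (σ : Sector)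
    (s : ℝ) :
    HasDerivAt (fun u => chargeVariation ℓ G t σ (F u) v)
      (chargeVariation ℓ G t σ (fun x => deriv (fun u => F u x) s) v) s := by
  simp only [chargeVariation_eq (hFc _).periodic hv.periodic,
    chargeVariation_eq (periodic_deriv_left hFc s) hv.periodic]
  have hFv : ContDiff ℝ ∞ (Function.uncurry fun u x => F u x * v x) :=
    hF.mul (hv.smooth.comp contDiff_snd)
  have h := (hasFDerivAt_parametric_integral (G := fun u x => F u x * v x)
    (hFv.of_le (by simp)) 0 (2 * Real.pi) s).hasDerivAt
  refine (h.const_mul _).congr_deriv ?_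
  congr 1
  rw [ContinuousLinearMap.intervalIntegral_apply]
  · refine intervalIntegral.integral_congr fun x _ => ?_
    rw [fderiv_eq_smul_deriv, one_smul]
    exact ((hasDerivAt_left hF s x).mul_const (v x)).deriv
  · have := (contDiff_fderiv_left (n := 0) (G := fun u x => F u x * v x)
      (by simpa using hFv.of_le (by simp))).continuous
    exact (this.comp (continuous_const.prodMk continuous_id)).intervalIntegrable _ _

/-- Integrability: the second variation of the Killing charge is symmetric, because the charge is
smooth on the plane spanned by two variations. -/
theorem chargeVariation_symm {ℓ G : ℝ} (hG : G ≠ 0) {f v₁ v₂ : ℝ → ℝ} (hf : IsCircleField f)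
    (hv₁ : IsCircleField v₁) (hv₂ : IsCircleField v₂) (t : ℝ) (σ : Sector) :
    chargeVariation ℓ G t σ (fun x => deriv (fun s : ℝ => orbitStabilizer (f + s • v₁) x) 0) v₂
      = chargeVariation ℓ G t σ
        (fun x => deriv (fun s : ℝ => orbitStabilizer (f + s • v₂) x) 0) v₁ := by
  set H : ℝ → ℝ → ℝ := fun s u => killingCharge ℓ G (f + s • v₁ + u • v₂) with hH
  have hHs : ContDiff ℝ ∞ (Function.uncurry H) := by
    have hF : ContDiff ℝ ∞ (Function.uncurry fun p : ℝ × ℝ => f + p.1 • v₁ + p.2 • v₂) :=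
      ((hf.smooth.comp contDiff_snd).add ((contDiff_fst.comp contDiff_fst).mul
        (hv₁.smooth.comp contDiff_snd))).add ((contDiff_snd.comp contDiff_fst).mul
        (hv₂.smooth.comp contDiff_snd))
    exact contDiff_const.mul (orbitLabel_spec.1.comp (contDiff_monodromyTrace hF))
  have hgrad : ∀ {g v : ℝ → ℝ}, IsCircleField g → IsCircleField v →
      HasDerivAt (fun u : ℝ => killingCharge ℓ G (g + u • v))
        (chargeVariation ℓ G t σ (orbitStabilizer g) v) 0 := fun {g v} hg hv => by
    have := hasDerivAt_killingCharge (ℓ := ℓ) hG (contDiff_add_smul hg.smooth hv.smooth)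
      (fun s => hg.add (hv.smul s)) σ t 0
    simpa only [deriv_add_smul, zero_smul, add_zero] using this
  have hsecond : ∀ {v : ℝ → ℝ} (_ : IsCircleField v) {w : ℝ → ℝ} (_ : IsCircleField w),
      HasDerivAt (fun s : ℝ => chargeVariation ℓ G t σ (orbitStabilizer (f + s • v)) w)
        (chargeVariation ℓ G t σ
          (fun x => deriv (fun s : ℝ => orbitStabilizer (f + s • v) x) 0) w) 0 := fun hv _ hw =>
    hasDerivAt_chargeVariation (contDiff_orbitStabilizer (contDiff_add_smul hf.smooth hv.smooth))
      (fun s => isCircleField_orbitStabilizer (hf.add (hv.smul s))) hw ℓ G t σ 0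
  have h1 : ∀ s, deriv (H s) 0 = chargeVariation ℓ G t σ (orbitStabilizer (f + s • v₁)) v₂ :=
    fun s => (hgrad (hf.add (hv₁.smul s)) hv₂).deriv
  have h2 : ∀ u, deriv (fun s => H s u) 0
      = chargeVariation ℓ G t σ (orbitStabilizer (f + u • v₂)) v₁ := fun u => by
    rw [← (hgrad (hf.add (hv₂.smul u)) hv₁).deriv]
    simp only [hH, add_right_comm]
  have h3 := hasDerivAt_deriv_right hHs 0 0
  simp only [h1, h2] at h3
  rw [(hsecond hv₂ hv₁).deriv] at h3
  exact (hsecond hv₁ hv₂).unique h3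

theorem isSingleValued_modeParam (τ : Sector) (n : ℤ) :
    IsSingleValued (fun σ x => (modeParam τ n σ x).re) ∧
      IsSingleValued (fun σ x => (modeParam τ n σ x).im) := by
  have hexp : ContDiff ℝ ∞ fun x : ℝ => Complex.exp (Complex.I * n * x) :=
    Complex.contDiff_exp.comp (contDiff_const.mul Complex.ofRealCLM.contDiff)
  have hper : ∀ x : ℝ, Complex.exp (Complex.I * n * ((x + 2 * Real.pi : ℝ) : ℂ))
      = Complex.exp (Complex.I * n * x) := fun x => by
    rw [← Complex.exp_periodic.int_mul n (Complex.I * n * x)]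
    congr 1
    push_cast
    ring
  constructor <;> intro σ <;> rcases eq_or_ne σ τ with rfl | h
  · simp only [modeParam, Pi.single_eq_same]
    exact ⟨Complex.reCLM.contDiff.comp hexp, fun x => by simp only [hper]⟩
  · simp only [modeParam, Pi.single_eq_of_ne h]
    exact isCircleField_const 0
  · simp only [modeParam, Pi.single_eq_same]
    exact ⟨Complex.imCLM.contDiff.comp hexp, fun x => by simp only [hper]⟩
  · simp only [modeParam, Pi.single_eq_of_ne h]
    exact isCircleField_const 0

theorem hasChargeBracket_killing_virasoro (ℓ G t : ℝ) {L : Fields} (hL : IsSingleValued L)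
    (σ τ : Sector) (n : ℤ) :
    HasChargeBracket (fun ρ x => (killingParam orbitStabilizer σ L ρ x : ℂ))
      (virasoroCharge ℓ G t τ n) L 0 := by
  have hs : ∀ τ, IsStabilizer (L τ) (killingParam orbitStabilizer σ L τ) :=
    isStabilizer_single (isStabilizer_orbitStabilizer (hL σ))
  have hre : deltaL (fun ρ x => ((killingParam orbitStabilizer σ L ρ x : ℝ) : ℂ).re) L = 0 := by
    simp only [Complex.ofReal_re]
    exact funext fun τ => (isStabilizer_iff_coadjointVariation (hs τ).smooth).1 (hs τ)
  have him : deltaL (fun ρ x => ((killingParam orbitStabilizer σ L ρ x : ℝ) : ℂ).im) L = 0 := by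
    simp only [Complex.ofReal_im]
    exact funext fun τ => (isStabilizer_iff_coadjointVariation (k := 0) contDiff_const).1
      (isStabilizer_zero (L τ))
  refine ⟨0, 0, ?_, ?_, by simp⟩
  · rw [hre]
    simpa using hasDerivAt_const (0 : ℝ) (virasoroCharge ℓ G t τ n L)
  · rw [him]
    simpa using hasDerivAt_const (0 : ℝ) (virasoroCharge ℓ G t τ n L)

theorem hasChargeBracket_virasoro_killing (ℓ : ℝ) {G : ℝ} (hG : G ≠ 0) {L : Fields}
    (hL : IsSingleValued L) (σ τ : Sector) (n : ℤ) :
    HasChargeBracket (modeParam τ n) (fun L' => (killingCharge ℓ G (L' σ) : ℂ)) L 0 := by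
  have key : ∀ {ε : Fields}, IsSingleValued ε →
      HasDerivAt (fun s : ℝ => (killingCharge ℓ G ((L + s • deltaL ε L) σ) : ℂ)) 0 0 := by
    intro ε hε
    have hδ := isCircleField_coadjointVariation (hε σ) (hL σ)
    have h := hasDerivAt_killingCharge (ℓ := ℓ) hG (contDiff_add_smul (hL σ).smooth hδ.smooth)
      (fun s => (hL σ).add (hδ.smul s)) σ 0 0
    simp only [deriv_add_smul, zero_smul, add_zero] at h
    have h0 := chargeVariation_coadjointVariation (hL σ) (hε σ)
      (isCircleField_orbitStabilizer (hL σ)) (isStabilizer_orbitStabilizer (hL σ)) ℓ G 0 σ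
    have h1 := (h.congr_deriv h0).ofReal_comp
    simpa using! h1
  exact ⟨0, 0, key (isSingleValued_modeParam τ n).1, key (isSingleValued_modeParam τ n).2, by simp⟩

end Banados

end

open Banados in
theorem mainTheorem6 :
    -- every geometry: Killing condition, and two commuting global Killing vectors
    (∀ ℓ : ℝ, 0 < ℓ → ∀ L : Fields, IsSingleValued L →
      (∀ ε : Fields, IsSingleValued ε →
        (IsGlobalKilling ℓ L (chi ℓ ε L) ↔ ∀ σ, IsStabilizer (L σ) (ε σ))) ∧
      ∃ k : Fields,
        (∀ σ, IsCircleField (k σ) ∧ k σ ≠ 0 ∧ IsHillProduct (L σ) (k σ) ∧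
          IsGlobalKilling ℓ L (chi ℓ (Pi.single σ (k σ)) L)) ∧
        (∀ a b : ℝ,
          (∀ p ∈ patch ℓ L, a • chi ℓ (Pi.single .plus (k .plus)) L p
            + b • chi ℓ (Pi.single .minus (k .minus)) L p = 0) → a = 0 ∧ b = 0) ∧
        ∀ p ∈ patch ℓ L,
          VectorField.lieBracket ℝ (chi ℓ (Pi.single .plus (k .plus)) L)
            (chi ℓ (Pi.single .minus (k .minus)) L) p = 0) ∧
    -- the field dependent choice `K_± = K(L_±)`
    ∃ K : (ℝ → ℝ) → ℝ → ℝ,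
      (∀ f, IsCircleField f →
        IsCircleField (K f) ∧ IsStabilizer f (K f) ∧ IsHillProduct f (K f) ∧
        (IsExceptional f ∨
          K f ≠ 0 ∧ ∀ k, IsCircleField k → IsStabilizer f k → ∃ a : ℝ, k = a • K f)) ∧
      -- smooth dependence on the fields
      (∀ F : ℝ → ℝ → ℝ, ContDiff ℝ ∞ (Function.uncurry F) → (∀ s, IsCircleField (F s)) →
        ContDiff ℝ ∞ (Function.uncurry fun s => K (F s))) ∧
      -- normalization at the constant representatives of the BTZ sector
      (∀ c : ℝ, 0 ≤ c → K (fun _ => c) = fun _ => 1) ∧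
      -- `ζ_±` commute with every symplectic symmetry
      (∀ ℓ : ℝ, 0 < ℓ → ∀ L ε : Fields, IsSingleValued L → IsSingleValued ε →
        ∀ σ, ∀ p ∈ patch ℓ L, adjustedBracket ℓ (fun _ => ε) (killingParam K σ) L p = 0) ∧
      -- the charges `J_±(L) = J(L_±)`
      ∀ ℓ G : ℝ, 0 < ℓ → 0 < G →
        -- integrability condition
        (∀ (σ : Sector) (t : ℝ) (f v₁ v₂ : ℝ → ℝ),
          IsCircleField f → IsCircleField v₁ → IsCircleField v₂ →
          HasDerivAt (fun s : ℝ => chargeVariation ℓ G t σ (K (f + s • v₁)) v₂)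
            (chargeVariation ℓ G t σ (fun x => deriv (fun s : ℝ => K (f + s • v₁) x) 0) v₂) 0 ∧
          chargeVariation ℓ G t σ (fun x => deriv (fun s : ℝ => K (f + s • v₁) x) 0) v₂
            = chargeVariation ℓ G t σ (fun x => deriv (fun s : ℝ => K (f + s • v₂) x) 0) v₁) ∧
        -- for any global Killing vector, also an extra one, `δ_ε` of its charge vanishes
        (∀ L ε : Fields, IsSingleValued L → IsSingleValued ε →
          ∀ (σ : Sector) (t : ℝ) (k : ℝ → ℝ), IsCircleField k → IsStabilizer (L σ) k →
            chargeVariation ℓ G t σ k (deltaL ε L σ) = 0) ∧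
        ∃ J : (ℝ → ℝ) → ℝ,
          -- `δJ_± = (ℓ / 8πG) ∮ dφ K_± δL_±` along every path in phase space
          (∀ F : ℝ → ℝ → ℝ, ContDiff ℝ ∞ (Function.uncurry F) → (∀ s, IsCircleField (F s)) →
            ∀ (σ : Sector) (t s : ℝ),
              HasDerivAt (fun u => J (F u))
                (chargeVariation ℓ G t σ (K (F s)) (fun x => deriv (fun u => F u x) s)) s) ∧
          -- `{J_±, L_n} = {J_±, L̄_n} = 0`, and with the arguments exchanged
          (∀ L : Fields, IsSingleValued L → ∀ (σ τ : Sector) (n : ℤ) (t : ℝ),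
            HasChargeBracket (fun ρ x => (killingParam K σ L ρ x : ℂ))
              (virasoroCharge ℓ G t τ n) L 0 ∧
            HasChargeBracket (modeParam τ n) (fun L' => (J (L' σ) : ℂ)) L 0) ∧
          -- constancy on coadjoint orbits
          (∀ f h, IsCircleField f → IsCircleDiffeo h → J (coadjointAction h f) = J f) ∧
          -- the value on the BTZ sector
          (∀ c : ℝ, 0 ≤ c → ∀ h, IsCircleDiffeo h →
            J (coadjointAction h fun _ => c) = ℓ / (4 * G) * c) := by
  refine ⟨fun ℓ hℓ L hL => ⟨fun ε hε => isGlobalKilling_chi_iff hℓ hL hε, ?_⟩, orbitStabilizer,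
    fun f hf => ⟨isCircleField_orbitStabilizer hf, isStabilizer_orbitStabilizer hf,
      isHillProduct_orbitStabilizer hf, isExceptional_or_orbitStabilizer hf⟩,
    fun F hF _ => contDiff_orbitStabilizer hF, fun c hc => orbitStabilizer_const hc,
    fun ℓ _ L ε hL hε σ p hp => adjustedBracket_killingParam hL hε σ hp, fun ℓ G _ hG =>
    ⟨fun σ t f v₁ v₂ hf hv₁ hv₂ => ⟨?_, chargeVariation_symm hG.ne' hf hv₁ hv₂ t σ⟩,
      fun L ε hL hε σ t k hk hs => chargeVariation_coadjointVariation (hL σ) (hε σ) hk hs ℓ G t σ,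
      killingCharge ℓ G, fun F hF hFc σ t s => hasDerivAt_killingCharge hG.ne' hF hFc σ t s,
      fun L hL σ τ n t => ⟨hasChargeBracket_killing_virasoro ℓ G t hL σ τ n,
        hasChargeBracket_virasoro_killing ℓ hG.ne' hL σ τ n⟩,
      fun f h hf hh => killingCharge_coadjointAction ℓ G hf hh, fun c hc h hh =>
        (killingCharge_coadjointAction ℓ G (isCircleField_const c) hh).trans
          (killingCharge_const ℓ G hc)⟩⟩
  · choose k hk h0 hp hs using fun σ => exists_ne_zero_isStabilizer (hL σ)
    exact ⟨k, fun σ => ⟨hk σ, h0 σ, hp σ, (isGlobalKilling_chi_iff hℓ hL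
      (isSingleValued_single (hk σ))).2 (isStabilizer_single (hs σ))⟩,
      chi_single_linearIndependent h0,
      fun p => lieBracket_chi_single (fun σ => (hL σ).smooth) (hs .plus) (hs .minus)⟩
  · exact hasDerivAt_chargeVariation
      (contDiff_orbitStabilizer (contDiff_add_smul hf.smooth hv₁.smooth))
      (fun s => isCircleField_orbitStabilizer (hf.add (hv₁.smul s))) hv₂ ℓ G t σ 0
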